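/- Let $\gamma>1$, $R>0$, $\delta>0$. A state $U=(u,\rho,p)$ of a polytropic gas has $\rho>0$, $p>0$, temperature $T=\frac{p}{R\rho}$, Bernoulli function $\Phi=\frac12u^2+\frac{\gamma}{\gamma-1}\frac p\rho$ and Mach number $M=|u|/\sqrt{\gamma p/\rho}$. Let $U_0=(q_0,\rho_0,p_0)$ be a supersonic state ($q_0>0$, $M_0>1$) and let $U_1=(q_1,\rho_1,p_1)$ be the subsonic state ($M_1<1$) connected to it by the Rankine–Hugoniot conditions $\rho_0q_0=\rho_1q_1$, $\rho_0q_0^2+p_0=\rho_1q_1^2+p_1$, $\Phi_0=\Phi_1$. Suppose that $$1<M_0^2<\frac{2\gamma}{\gamma-1}.$$ For $\mu>0$ consider the boundary value problem on $[0,1]$ $$\partial_x(\rho u)=0,\quad \partial_x(\rho u^2+p)=\mu\,\partial_x(T^\delta\partial_xu),\quad \partial_x(\rho u\Phi)=\mu\,\partial_x(T^\delta u\,\partial_xu),\qquad U(0)=U_0,\ u(1)=q_1; \tag{VP}$$ its solutions are understood to have $\rho,p>0$ on $[0,1]$. Put $$X=\left(1+\left(\frac{\frac{\gamma+1}{\gamma-1}-\frac{q_1}{q_0}}{\frac{\gamma+1}{\gamma-1}-\frac{q_0}{q_1}}\right)^{\delta}\frac{q_1}{q_0}\right)^{-1},\qquad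 \hat U(x)=\begin{cases}U_0,&x<X,\\U_1,&x>X.\end{cases}$$ Then $$X=\left(1+\left(\frac{M_0}{M_1}\right)^{2\delta}\left(\frac{1-M_0^{-2}}{M_1^{-2}-1}\right)^{1+2\delta}\right)^{-1}\in(0,1),$$ and $\hat U$ is a normal shock solution of the Euler system: it is a weak solution on $(0,1)$ of $\partial_x(\rho u)=\partial_x(\rho u^2+p)=\partial_x(\rho u\Phi)=0$, and $p_1>p_0$. Moreover: 1. If $0<\delta\le1$, there is $\mu_1>0$ such that for every $\mu\in(0,\mu_1)$ the problem (VP) has a unique solution $U^\mu\in C^2[0,1]$, and $U^\mu\to\hat U$ in $L^1(0,1)$ as $\mu\to0^+$. 2. If $\delta>1$, there is $\mu_2>0$ such that for every $\mu\in(0,\mu_2)$ the problem (VP) has exactly two solutions $U_1^\mu,U_2^\mu$ in $C^2[0,1]$. They can be labelled so that $U_1^\mu\to\hat U$ in $L^1(0,1)$ as $\mu\to0^+$, while $U_2^\mu$ does not converge in $L^1(0,1)$ to any limit, not even along some sequence $\mu_n\to0^+$, and $\mu\,T(U_0)^\delta\,\partial_xu_{2}^{\mu}(0)\to-\infty$ as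 $\mu\to0^+$, where $u_2^\mu$ is the velocity component of $U_2^\mu$ and $T(U_0)=\frac{p_0}{R\rho_0}$. -/

import Mathlib

open Set Filter Topology MeasureTheory
open scoped ENNReal ContDiff

noncomputable section

namespace PolytropicFlow

/-- The state `(u, ρ, p)` of a one-dimensional gas flow: velocity, density, pressure. -/
@[ext]
structure GasState where
  u : ℝ
  ρ : ℝ
  p : ℝ

/-- Positive density and pressure (hence positive temperature). -/
def GasState.IsPhysical (U : GasState) : Prop := 0 < U.ρ ∧ 0 < U.p

/-- Internal energy `e = p / ((γ - 1) ρ)` of a polytropic gas. -/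
def internalEnergy (γ : ℝ) (U : GasState) : ℝ := 1 / (γ - 1) * (U.p / U.ρ)

/-- Bernoulli function `Φ = u² / 2 + i`, with `i = e + p / ρ` the enthalpy. -/
def bernoulliFunction (γ : ℝ) (U : GasState) : ℝ :=
  U.u ^ 2 / 2 + (internalEnergy γ U + U.p / U.ρ)

/-- Temperature, from `p = ρ R T`. -/
def temperature (R : ℝ) (U : GasState) : ℝ := U.p / (R * U.ρ)

/-- Sound speed `c = √(γ p / ρ)`. -/
def soundSpeed (γ : ℝ) (U : GasState) : ℝ := √(γ * U.p / U.ρ)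

/-- Mach number `M = |u| / c`. -/
def machNumber (γ : ℝ) (U : GasState) : ℝ := |U.u| / soundSpeed γ U

/-- Mass flux `ρ u`. -/
def massFlux (U : GasState) : ℝ := U.ρ * U.u

/-- Momentum flux `ρ u² + p`. -/
def momentumFlux (U : GasState) : ℝ := U.ρ * U.u ^ 2 + U.p

/-- Energy flux `ρ u Φ`. -/
def energyFlux (γ : ℝ) (U : GasState) : ℝ := U.ρ * U.u * bernoulliFunction γ U

/-- The Rankine–Hugoniot conditions for a steady normal shock. -/
structure RankineHugoniot (γ : ℝ) (U₀ U₁ : GasState) : Prop where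
  mass : massFlux U₀ = massFlux U₁
  momentum : momentumFlux U₀ = momentumFlux U₁
  energy : bernoulliFunction γ U₀ = bernoulliFunction γ U₁

/-- `U₀` is a supersonic state moving to the right, and `U₁` is the subsonic state connected to it
by a normal shock. -/
structure IsShockPair (γ : ℝ) (U₀ U₁ : GasState) : Prop where
  physical₀ : U₀.IsPhysical
  physical₁ : U₁.IsPhysical
  velocity_pos : 0 < U₀.u
  supersonic : 1 < machNumber γ U₀
  subsonic : machNumber γ U₁ < 1
  rankineHugoniot : RankineHugoniot γ U₀ U₁

/-- The piecewise constant flow with state `U₀` ahead of the front `xs` and `U₁` behind it. -/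
def normalShock (U₀ U₁ : GasState) (xs : ℝ) (x : ℝ) : GasState := if x < xs then U₀ else U₁

/-- `∂ₓ F = 0` on `(0, 1)` in the sense of distributions. -/
def WeaklyConserved (F : ℝ → ℝ) : Prop :=
  LocallyIntegrableOn F (Ioo 0 1) ∧
    ∀ φ : ℝ → ℝ, ContDiff ℝ ∞ φ → HasCompactSupport φ → tsupport φ ⊆ Ioo 0 1 →
      ∫ x in Ioo (0 : ℝ) 1, F x * deriv φ x = 0

/-- Weak solutions on `(0, 1)` of the steady Euler system
`∂ₓ(ρu) = 0`, `∂ₓ(ρu² + p) = 0`, `∂ₓ(ρuΦ) = 0`. -/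
structure IsEulerWeakSolution (γ : ℝ) (U : ℝ → GasState) : Prop where
  mass : WeaklyConserved fun x => massFlux (U x)
  momentum : WeaklyConserved fun x => momentumFlux (U x)
  energy : WeaklyConserved fun x => energyFlux γ (U x)

/-- `V` is one of the normal shock solutions of the Euler system joining `U₀` to `U₁` with the front
inside the nozzle, satisfying the entropy condition. -/
def IsNormalShockSolution (γ : ℝ) (U₀ U₁ : GasState) (V : ℝ → GasState) : Prop :=
  (∃ xs ∈ Ioo (0 : ℝ) 1, V = normalShock U₀ U₁ xs) ∧ IsEulerWeakSolution γ V ∧ U₀.p < U₁.p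

/-- `U ∈ C²[0, 1]` solves the steady Navier–Stokes system with viscosity `μ T ^ δ`,
`∂ₓ(ρu) = 0`, `∂ₓ(ρu² + p) = μ ∂ₓ(T^δ ∂ₓu)`, `∂ₓ(ρuΦ) = μ ∂ₓ(T^δ u ∂ₓu)`,
with the boundary conditions `U(0) = U₀`, `u(1) = q₁`. -/
structure IsViscousShockSolution (γ R δ μ : ℝ) (U₀ U₁ : GasState) (U : ℝ → GasState) : Prop where
  contDiffOn_u : ContDiffOn ℝ 2 (fun x => (U x).u) (Icc 0 1)
  contDiffOn_ρ : ContDiffOn ℝ 2 (fun x => (U x).ρ) (Icc 0 1)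
  contDiffOn_p : ContDiffOn ℝ 2 (fun x => (U x).p) (Icc 0 1)
  physical : ∀ x ∈ Icc (0 : ℝ) 1, (U x).IsPhysical
  mass : ∀ x ∈ Ioo (0 : ℝ) 1, deriv (fun y => massFlux (U y)) x = 0
  momentum : ∀ x ∈ Ioo (0 : ℝ) 1, deriv (fun y => momentumFlux (U y)) x =
    μ * deriv (fun y => temperature R (U y) ^ δ * deriv (fun z => (U z).u) y) x
  energy : ∀ x ∈ Ioo (0 : ℝ) 1, deriv (fun y => energyFlux γ (U y)) x =
    μ * deriv (fun y => temperature R (U y) ^ δ * (U y).u * deriv (fun z => (U z).u) y) x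
  entrance : U 0 = U₀
  exit : (U 1).u = U₁.u

/-- The viscous stress `α = μ T(0)^δ ∂ₓu(0)` at the entrance (with the one-sided derivative). -/
def entranceStress (R δ μ : ℝ) (U : ℝ → GasState) : ℝ :=
  μ * temperature R (U 0) ^ δ * derivWithin (fun x => (U x).u) (Icc 0 1) 0

/-- All three components of `V` lie in `L¹(0, 1)`. -/
def IntegrableState (V : ℝ → GasState) : Prop :=
  IntegrableOn (fun x => (V x).u) (Ioo 0 1) ∧ IntegrableOn (fun x => (V x).ρ) (Ioo 0 1) ∧
    IntegrableOn (fun x => (V x).p) (Ioo 0 1)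

/-- The family `U i` converges to `V` in `L¹(0, 1)` (componentwise) along the filter `l`. -/
def TendstoL1 {ι : Type*} (U : ι → ℝ → GasState) (V : ℝ → GasState) (l : Filter ι) : Prop :=
  Tendsto (fun i => eLpNorm (fun x => (U i x).u - (V x).u) 1 (volume.restrict (Ioo 0 1))) l (𝓝 0) ∧
  Tendsto (fun i => eLpNorm (fun x => (U i x).ρ - (V x).ρ) 1 (volume.restrict (Ioo 0 1))) l (𝓝 0) ∧
  Tendsto (fun i => eLpNorm (fun x => (U i x).p - (V x).p) 1 (volume.restrict (Ioo 0 1))) l (𝓝 0)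

/-- The selected position of the shock front, in terms of the velocities `q₀`, `q₁`. -/
def shockPosition (γ δ q₀ q₁ : ℝ) : ℝ :=
  (1 + (((γ + 1) / (γ - 1) - q₁ / q₀) / ((γ + 1) / (γ - 1) - q₀ / q₁)) ^ δ * (q₁ / q₀))⁻¹

end PolytropicFlow

end

/-! Integrating the three equations once leaves one free constant, the entrance stress, written `-(m
* s)`. Density and pressure become explicit functions of the velocity and `s`, and the momentum and
energy equations collapse to a single scalar equation `μ T^δ u u' = -m D`. Here `D = drop s u` is a
quadratic vanishing at `q₀` and `q₁` plus `s * h u`. The bound on the Mach number says exactly that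
`h` is positive at `q₁`, hence on `[q₁, q₀]`.

A barrier argument (`reduced_bounds`) shows that a solution has `s > 0` and velocities in `[q₁,
q₀]`. Separating variables then identifies the solutions with the roots `s > 0` of `μ * travel s =
m`, where `travel s` is the integral of `u T^δ / D` over `[q₁, q₀]` (`flow_isViscousShockSolution`,
`exists_eqOn_flow`). Counting solutions for small `μ` means counting the points where `travel` takes
a large value.

As `s → 0⁺`, the zeros of `D` at `s = 0` produce a logarithmic divergence at each end, with
coefficients `weight q₀` and `weight q₁` (`exists_log_asymp`), and `travel` is strictly decreasing
there (`exists_strictAntiOn_travel`). Since all but a bounded part of the distance is spent near the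
two end states, the profile tends to a step whose position is the share `weight q₀ / (weight q₁ +
weight q₀)` (`tendsto_fraction`, `tendsto_flow`).

As `s → ∞`, both `T` and `D` are of order `s` away from `q₀`, so `travel` is of order `s^(δ-1)`. For
`δ ≤ 1` it stays bounded and only the first branch reaches large values. For `δ > 1` it is
eventually strictly increasing to infinity (`exists_strictMonoOn_travel`), which gives one further
solution. On that branch the pressure is of order `s` on a fixed interval, which rules out
convergence in `L¹` (`not_tendsto_flow`). -/

namespace PolytropicFlow

/-! ### The reduced equation: signs and continuity of its coefficients. -/

/-- The parameters of the viscous shock problem: the gas constants, the mass flux `m` and the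
velocities `q₀ > q₁` ahead of and behind the shock. -/
structure Params where
  γ : ℝ
  R : ℝ
  δ : ℝ
  m : ℝ
  q₀ : ℝ
  q₁ : ℝ
  one_lt_γ : 1 < γ
  R_pos : 0 < R
  δ_pos : 0 < δ
  m_pos : 0 < m
  q₁_pos : 0 < q₁
  q₁_lt_q₀ : q₁ < q₀
  mul_q₀_lt : (γ - 1) * q₀ < γ * q₁

namespace Params

variable (P : Params)

/-- The temperature of the inviscid flow, as a function of the velocity and up to a constant. -/
noncomputable def g (u : ℝ) : ℝ :=
  u ^ 2 / 2 - (P.γ + 1) / (2 * P.γ) * (P.q₀ + P.q₁) * u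
    + (P.γ + 1) / (2 * (P.γ - 1)) * P.q₀ * P.q₁

/-- The coefficient of the stress parameter in the reduced equation. -/
def h (u : ℝ) : ℝ := P.γ * u - (P.γ - 1) * P.q₀

/-- The temperature as a function of the stress parameter and the velocity. -/
noncomputable def temp (s u : ℝ) : ℝ := (P.γ - 1) / P.R * (P.g u + s * (P.q₀ - u))

/-- The reduced equation is `μ T ^ δ u u' = -m D` with `D = P.drop s u`. -/
noncomputable def drop (s u : ℝ) : ℝ :=
  (P.γ + 1) / 2 * (P.q₀ - u) * (u - P.q₁) + s * P.h u

/-- The distance travelled per unit of velocity, for `m = μ`. -/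
noncomputable def dist (s u : ℝ) : ℝ := u * P.temp s u ^ P.δ / P.drop s u

/-- The total distance between the velocities `q₀` and `q₁`, for `m = μ`. -/
noncomputable def travel (s : ℝ) : ℝ := ∫ u in P.q₁..P.q₀, P.dist s u

/-- Projection of the velocity to `[q₁, q₀]`. -/
noncomputable def clamp (u : ℝ) : ℝ := max P.q₁ (min u P.q₀)

variable {P} {s s' u : ℝ}

lemma γ_pos : 0 < P.γ := by linarith [P.one_lt_γ]

lemma q₀_pos : 0 < P.q₀ := P.q₁_pos.trans P.q₁_lt_q₀

lemma factor_pos : 0 < (P.γ - 1) / P.R := div_pos (by linarith [P.one_lt_γ]) P.R_pos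

lemma g_q₀ : P.g P.q₀ =
    P.q₀ * P.q₁ / (2 * P.γ) * ((P.γ + 1) / (P.γ - 1) - P.q₀ / P.q₁) := by
  have h1 := P.one_lt_γ
  have h2 := P.q₁_pos
  have h3 : P.γ - 1 ≠ 0 := by linarith
  have h4 : P.γ ≠ 0 := by linarith
  unfold g
  field_simp
  ring

lemma g_q₁ : P.g P.q₁ =
    P.q₀ * P.q₁ / (2 * P.γ) * ((P.γ + 1) / (P.γ - 1) - P.q₁ / P.q₀) := by
  have h1 := P.one_lt_γ
  have h2 := P.q₀_pos
  have h3 : P.γ - 1 ≠ 0 := by linarith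
  have h4 : P.γ ≠ 0 := by linarith
  unfold g
  field_simp
  ring

lemma ratio_bound : P.q₀ / P.q₁ < (P.γ + 1) / (P.γ - 1) := by
  rw [div_lt_div_iff₀ P.q₁_pos (by linarith [P.one_lt_γ])]
  nlinarith [P.mul_q₀_lt, P.q₁_pos]

lemma g_q₀_pos : 0 < P.g P.q₀ := by
  rw [g_q₀]
  have h1 := P.ratio_bound
  have h2 := P.q₁_pos
  have h3 := P.q₀_pos
  have h4 := P.γ_pos
  exact mul_pos (by positivity) (by linarith)

/-- The right side is the vertex of the parabola `g`. Since it is not to the left of `q₀`, `g`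
decreases up to `q₀`, and positivity of the temperature only has to be checked there. -/
lemma g_slope : P.q₀ ≤ (P.γ + 1) / (2 * P.γ) * (P.q₀ + P.q₁) := by
  have h4 := P.γ_pos
  rw [div_mul_eq_mul_div, le_div_iff₀ (by positivity)]
  nlinarith [P.mul_q₀_lt, P.q₁_pos]

lemma g_anti {v w : ℝ} (h1 : v ≤ w) (h2 : w ≤ P.q₀) : P.g w ≤ P.g v := by
  have h3 := P.g_slope
  unfold g
  nlinarith [mul_nonneg (sub_nonneg.2 h1)
    (show 0 ≤ (P.γ + 1) / (2 * P.γ) * (P.q₀ + P.q₁) - (v + w) / 2 by linarith)]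

lemma g_pos (h2 : u ≤ P.q₀) : 0 < P.g u := g_q₀_pos.trans_le (g_anti h2 le_rfl)

/-- The Mach number bound enters here. It makes `drop` positive for every `s > 0` and increasing in
`s` on `[q₁, q₀]`. -/
lemma h_q₁_pos : 0 < P.h P.q₁ := by unfold h; linarith [P.mul_q₀_lt]

lemma h_q₀ : P.h P.q₀ = P.q₀ := by unfold h; ring

lemma h_mono {v w : ℝ} (h1 : v ≤ w) : P.h v ≤ P.h w := by
  unfold h; nlinarith [P.γ_pos]

lemma h_pos (h1 : P.q₁ ≤ u) : 0 < P.h u := h_q₁_pos.trans_le (h_mono h1)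

lemma h_le (h1 : u ≤ P.q₀) : P.h u ≤ P.q₀ := by simpa [h_q₀] using P.h_mono h1

lemma temp_pos (hs : 0 ≤ s) (h2 : u ≤ P.q₀) : 0 < P.temp s u :=
  mul_pos factor_pos (add_pos_of_pos_of_nonneg (g_pos h2) (mul_nonneg hs (by linarith)))

lemma bulk_nonneg (h1 : P.q₁ ≤ u) (h2 : u ≤ P.q₀) :
    0 ≤ (P.γ + 1) / 2 * (P.q₀ - u) * (u - P.q₁) :=
  mul_nonneg (mul_nonneg (by linarith [P.γ_pos]) (by linarith)) (by linarith)

lemma drop_ge (hs : 0 ≤ s) (h1 : P.q₁ ≤ u) (h2 : u ≤ P.q₀) : s * P.h P.q₁ ≤ P.drop s u := by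
  unfold drop
  have := P.bulk_nonneg h1 h2
  have := mul_le_mul_of_nonneg_left (P.h_mono h1) hs
  linarith

lemma drop_pos (hs : 0 < s) (h1 : P.q₁ ≤ u) (h2 : u ≤ P.q₀) : 0 < P.drop s u :=
  (mul_pos hs h_q₁_pos).trans_le (drop_ge hs.le h1 h2)

lemma drop_mono (hs : s ≤ s') (h1 : P.q₁ ≤ u) : P.drop s u ≤ P.drop s' u := by
  unfold drop
  have := mul_le_mul_of_nonneg_right hs (P.h_pos h1).le
  linarith

lemma dist_pos (hs : 0 < s) (h1 : P.q₁ ≤ u) (h2 : u ≤ P.q₀) : 0 < P.dist s u :=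
  div_pos (mul_pos (P.q₁_pos.trans_le h1) (Real.rpow_pos_of_pos (temp_pos hs.le h2) _))
    (drop_pos hs h1 h2)

lemma continuous_g : Continuous P.g := by unfold g; fun_prop

lemma continuous_h : Continuous P.h := by unfold h; fun_prop

lemma continuous_temp : Continuous fun x : ℝ × ℝ => P.temp x.1 x.2 := by
  have := P.continuous_g
  unfold temp; fun_prop

lemma continuous_drop : Continuous fun x : ℝ × ℝ => P.drop x.1 x.2 := by
  have := P.continuous_h
  unfold drop; fun_prop

lemma continuous_temp_right (s : ℝ) : Continuous (P.temp s) :=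
  P.continuous_temp.comp (by fun_prop : Continuous fun u : ℝ => (s, u))

lemma continuous_drop_right (s : ℝ) : Continuous (P.drop s) :=
  P.continuous_drop.comp (by fun_prop : Continuous fun u : ℝ => (s, u))

lemma continuousOn_dist :
    ContinuousOn (fun x : ℝ × ℝ => P.dist x.1 x.2) (Ioi 0 ×ˢ Icc P.q₁ P.q₀) := by
  unfold dist
  refine ContinuousOn.div (continuous_snd.continuousOn.mul
    (continuous_temp.continuousOn.rpow_const fun x hx => Or.inl ?_))
    continuous_drop.continuousOn fun x hx => ?_
  · exact (temp_pos (le_of_lt hx.1) hx.2.2).ne'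
  · exact (drop_pos hx.1 hx.2.1 hx.2.2).ne'

lemma continuousOn_dist_right (hs : 0 < s) : ContinuousOn (P.dist s) (Icc P.q₁ P.q₀) :=
  continuousOn_dist.comp (f := fun u : ℝ => (s, u)) (by fun_prop) fun _ hu => ⟨hs, hu⟩

lemma clamp_mem (u : ℝ) : P.clamp u ∈ Icc P.q₁ P.q₀ :=
  ⟨le_max_left _ _, max_le P.q₁_lt_q₀.le (min_le_right _ _)⟩

lemma clamp_of_mem (h1 : P.q₁ ≤ u) (h2 : u ≤ P.q₀) : P.clamp u = u := by
  simp [clamp, h1, h2]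

lemma continuous_clamp : Continuous P.clamp := by unfold clamp; fun_prop

lemma continuous_dist_clamp (hs : 0 < s) : Continuous fun u => P.dist s (P.clamp u) :=
  (continuousOn_dist_right hs).comp_continuous continuous_clamp clamp_mem

lemma dist_clamp_pos (hs : 0 < s) (u : ℝ) : 0 < P.dist s (P.clamp u) :=
  dist_pos hs (clamp_mem u).1 (clamp_mem u).2

lemma integral_clamp {a b : ℝ} (ha : P.q₁ ≤ a) (hab : a ≤ b) (hb : b ≤ P.q₀) :
    ∫ u in a..b, P.dist s (P.clamp u) = ∫ u in a..b, P.dist s u := by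
  refine intervalIntegral.integral_congr fun u hu => ?_
  rw [uIcc_of_le hab] at hu
  rw [clamp_of_mem (ha.trans hu.1) (hu.2.trans hb)]

lemma intervalIntegrable_dist (hs : 0 < s) {a b : ℝ} (ha : P.q₁ ≤ a) (hab : a ≤ b)
    (hb : b ≤ P.q₀) : IntervalIntegrable (P.dist s) volume a b :=
  ((continuousOn_dist_right hs).mono (by rw [uIcc_of_le hab]; exact Icc_subset_Icc ha hb)
    ).intervalIntegrable

lemma travel_pos (hs : 0 < s) : 0 < P.travel s :=
  intervalIntegral.intervalIntegral_pos_of_pos_on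
    (intervalIntegrable_dist hs le_rfl P.q₁_lt_q₀.le le_rfl)
    (fun _ hu => dist_pos hs hu.1.le hu.2.le) P.q₁_lt_q₀

end Params

/-! ### Elementary estimates: logarithmic integrals, tangent lines, Lipschitz bounds. -/

/-- Comparison of a nearly singular integrand with its model `c / (v + s)`. -/
lemma abs_div_sub_div_le {N d h v s k c B : ℝ} (hk : 0 < k) (hv : 0 ≤ v) (hs : 0 < s)
    (hd : k ≤ d) (hh : k ≤ h) (h1 : |N - c * d| ≤ B * (v + s)) (h2 : |N - c * h| ≤ B) :
    |N / (v * d + s * h) - c / (v + s)| ≤ B / k + B / k * (s / (v + s) ^ 2) := by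
  have hvs : 0 < v + s := by linarith
  have hE : k * (v + s) ≤ v * d + s * h := by nlinarith
  have hE0 : 0 < v * d + s * h := lt_of_lt_of_le (by positivity) hE
  have hB : 0 ≤ B := (abs_nonneg _).trans h2
  -- The error in the numerator splits along the two summands of the denominator. The part weighted
  -- by `s` need not be small, which is why `s / (v + s) ^ 2` appears in the bound.
  have e1 : N / (v * d + s * h) - c / (v + s) =
      ((N - c * d) * v + (N - c * h) * s) / ((v * d + s * h) * (v + s)) := by
    field_simp
    ring
  have e2 : B / k + B / k * (s / (v + s) ^ 2) =
      (B * (v + s) * (v + s) + B * s) / (k * (v + s) * (v + s)) := by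
    field_simp
  rw [e1, e2, abs_div, abs_of_pos (mul_pos hE0 hvs)]
  gcongr
  calc |(N - c * d) * v + (N - c * h) * s| ≤ |N - c * d| * v + |N - c * h| * s := by
        refine (abs_add_le _ _).trans ?_
        rw [abs_mul, abs_mul, abs_of_nonneg hv, abs_of_pos hs]
    _ ≤ B * (v + s) * (v + s) + B * s := by
        gcongr
        linarith

/-- The term `s / (v + s) ^ 2` is large near `v = 0`, but its integral is `1 - s / (η + s) ≤ 1`. The
total error is therefore bounded uniformly in `s`. -/
lemma abs_integral_sub_log_le {F : ℝ → ℝ} {η s c A : ℝ} (hη : 0 ≤ η) (hs : 0 < s)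
    (hA : 0 ≤ A) (hF : IntervalIntegrable F volume 0 η)
    (hb : ∀ v ∈ Icc 0 η, |F v - c / (v + s)| ≤ A + A * (s / (v + s) ^ 2)) :
    |(∫ v in 0..η, F v) - c * (Real.log (η + s) - Real.log s)| ≤ A * (η + 1) := by
  have hpos : ∀ v ∈ uIcc 0 η, v + s ≠ 0 := fun v hv => by
    rw [uIcc_of_le hη] at hv
    linarith [hv.1]
  have hc1 : ContinuousOn (fun v => c / (v + s)) (uIcc 0 η) :=
    continuousOn_const.div (by fun_prop) hpos
  have hc2 : ContinuousOn (fun v => A + A * (s / (v + s) ^ 2)) (uIcc 0 η) :=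
    continuousOn_const.add (continuousOn_const.mul
      (continuousOn_const.div (by fun_prop) fun v hv => pow_ne_zero 2 (hpos v hv)))
  have i1 : ∫ v in 0..η, c / (v + s) = c * (Real.log (η + s) - Real.log s) := by
    rw [intervalIntegral.integral_eq_sub_of_hasDerivAt (f := fun v => c * Real.log (v + s))
      (fun v hv => ?_) hc1.intervalIntegrable]
    · rw [zero_add]; ring
    · have := (((hasDerivAt_id v).add_const s).log (hpos v hv)).const_mul c
      simpa [div_eq_mul_inv] using this
  have i2 : ∫ v in 0..η, (A + A * (s / (v + s) ^ 2)) = A * (η + 1) - A * (s / (η + s)) := by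
    rw [intervalIntegral.integral_eq_sub_of_hasDerivAt
      (f := fun v => A * v - A * (s * (v + s)⁻¹)) (fun v hv => ?_) hc2.intervalIntegrable]
    · rw [zero_add, mul_inv_cancel₀ hs.ne', div_eq_mul_inv]; ring
    · have h0 := (((hasDerivAt_id v).add_const s).inv (hpos v hv)).const_mul s
      have := ((hasDerivAt_id v).const_mul A).sub (h0.const_mul A)
      refine this.congr_deriv ?_
      simp only [id]
      ring
  rw [← i1, ← intervalIntegral.integral_sub hF hc1.intervalIntegrable]
  have key := intervalIntegral.norm_integral_le_of_norm_le (μ := volume) hη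
    (f := fun v => F v - c / (v + s)) (g := fun v => A + A * (s / (v + s) ^ 2))
    (Eventually.of_forall fun v hv => hb v ⟨hv.1.le, hv.2⟩) hc2.intervalIntegrable
  rw [i2] at key
  refine key.trans ?_
  have : 0 ≤ A * (s / (η + s)) := by positivity
  linarith

/-- Tangent line inequality for `x ^ δ`. -/
lemma rpow_tangent_le {x y δ : ℝ} (hx : 0 < x) (hy : 0 ≤ y) (hδ : 1 ≤ δ) :
    x ^ δ + δ * x ^ (δ - 1) * (y - x) ≤ y ^ δ := by
  have h1 := one_add_mul_self_le_rpow_one_add (s := y / x - 1) (p := δ)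
    (by have : 0 ≤ y / x := by positivity
        linarith) hδ
  rw [add_sub_cancel, Real.div_rpow hy hx.le, le_div_iff₀ (Real.rpow_pos_of_pos hx _)] at h1
  refine le_of_eq_of_le ?_ h1
  rw [Real.rpow_sub_one hx.ne']
  field_simp

lemma exists_lipschitz_of_contDiffOn {f : ℝ × ℝ → ℝ} {K : Set (ℝ × ℝ)} (hK : IsCompact K)
    (hc : Convex ℝ K) (hf : ContDiffOn ℝ 1 f K) :
    ∃ C : ℝ, 0 < C ∧ ∀ x ∈ K, ∀ y ∈ K, |f x - f y| ≤ C * (|x.1 - y.1| + |x.2 - y.2|) := by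
  obtain ⟨C, hC⟩ := (hf.locallyLipschitzOn hc).exists_lipschitzOnWith_of_compact hK
  refine ⟨C + 1, by positivity, fun x hx y hy => ?_⟩
  have := hC.dist_le_mul x hx y hy
  rw [Real.dist_eq, Prod.dist_eq, Real.dist_eq, Real.dist_eq] at this
  refine this.trans ?_
  have h0 := C.coe_nonneg
  have h1 : max |x.1 - y.1| |x.2 - y.2| ≤ |x.1 - y.1| + |x.2 - y.2| :=
    max_le (by simp) (by simp)
  have h2 : 0 ≤ |x.1 - y.1| + |x.2 - y.2| := by positivity
  nlinarith

/-! ### Logarithmic asymptotics of the travelled distance as `s → 0⁺`. -/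

namespace Params

variable {P : Params} {s s' u : ℝ}

lemma contDiffOn_temp_rpow :
    ContDiffOn ℝ 1 (fun x : ℝ × ℝ => P.temp x.1 x.2 ^ P.δ) (Icc 0 1 ×ˢ Icc P.q₁ P.q₀) := by
  refine ContDiffOn.rpow_const_of_ne (ContDiff.contDiffOn ?_) fun x hx =>
    (temp_pos hx.1.1 hx.2.2).ne'
  unfold temp g
  fun_prop

lemma exists_lipschitz_temp_rpow : ∃ C : ℝ, 0 < C ∧ ∀ s ∈ Icc (0 : ℝ) 1, ∀ s' ∈ Icc (0 : ℝ) 1,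
    ∀ u ∈ Icc P.q₁ P.q₀, |P.temp s u ^ P.δ - P.temp s' u ^ P.δ| ≤ C * |s - s'| := by
  obtain ⟨C, hC, h⟩ := exists_lipschitz_of_contDiffOn (isCompact_Icc.prod isCompact_Icc)
    ((convex_Icc _ _).prod (convex_Icc _ _)) P.contDiffOn_temp_rpow
  exact ⟨C, hC, fun s hs s' hs' u hu => by simpa using h (s, u) ⟨hs, hu⟩ (s', u) ⟨hs', hu⟩⟩

lemma exists_lipschitz_num : ∃ C : ℝ, 0 < C ∧ ∀ s ∈ Icc (0 : ℝ) 1,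
    ∀ u ∈ Icc P.q₁ P.q₀, ∀ w ∈ Icc P.q₁ P.q₀,
    |u * P.temp s u ^ P.δ - w * P.temp 0 w ^ P.δ| ≤ C * (|u - w| + s) := by
  obtain ⟨C, hC, h⟩ := exists_lipschitz_of_contDiffOn (isCompact_Icc.prod isCompact_Icc)
    ((convex_Icc _ _).prod (convex_Icc _ _))
    ((contDiff_snd (𝕜 := ℝ) (E := ℝ) (F := ℝ) (n := 1)).contDiffOn.mul P.contDiffOn_temp_rpow)
  refine ⟨C, hC, fun s hs u hu w hw => ?_⟩
  have := h (s, u) ⟨hs, hu⟩ (0, w) ⟨by simp, hw⟩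
  simpa [abs_of_nonneg hs.1, add_comm] using this

variable (P) in
/-- Weight of the logarithmic singularity of the travelled distance at an end state `q`. -/
noncomputable def weight (q : ℝ) : ℝ :=
  q * P.temp 0 q ^ P.δ / ((P.γ + 1) / 2 * (P.q₀ - P.q₁))

lemma weight_pos {q : ℝ} (h1 : P.q₁ ≤ q) (h2 : q ≤ P.q₀) : 0 < P.weight q := by
  have := P.γ_pos
  have := P.q₁_lt_q₀
  exact div_pos (mul_pos (P.q₁_pos.trans_le h1) (Real.rpow_pos_of_pos (temp_pos le_rfl h2) _))
    (mul_pos (by linarith) (by linarith))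

/-- The logarithmic asymptotics of the travelled distance at an end state `q`, parametrised by
the distance `v` to `q`. -/
lemma exists_log_asymp {q σ η : ℝ} (hq : q ∈ Icc P.q₁ P.q₀) (hσ : |σ| = 1) (hη : 0 < η)
    (hηL : η < P.q₀ - P.q₁)
    (hmem : ∀ v ∈ Icc 0 η, q + σ * v ∈ Icc P.q₁ P.q₀)
    (hfac : ∀ v, (P.q₀ - (q + σ * v)) * (q + σ * v - P.q₁) = v * (P.q₀ - P.q₁ - v)) :
    ∃ C : ℝ, ∀ s ∈ Ioc (0 : ℝ) 1,
      |(∫ v in 0..η, P.dist s (q + σ * v)) - P.weight q * -Real.log s| ≤ C := by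
  obtain ⟨C₁, hC₁, hN⟩ := P.exists_lipschitz_num
  have hγ := P.γ_pos
  have hw := P.weight_pos hq.1 hq.2
  set b := (P.γ + 1) / 2 with hb
  have hb0 : 0 < b := by positivity
  -- At distance `v` from `q`, `drop` equals `v * d + s * h` with `d = b * (q₀ - q₁ - v)`; `k`
  -- bounds both `d` and `h` from below.
  set k := min (b * (P.q₀ - P.q₁ - η)) (P.h P.q₁) with hk
  have hk0 : 0 < k := lt_min (mul_pos hb0 (by linarith)) h_q₁_pos
  set N₀ := q * P.temp 0 q ^ P.δ with hN₀
  have hN₀c : N₀ = P.weight q * (b * (P.q₀ - P.q₁)) := by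
    have : b * (P.q₀ - P.q₁) ≠ 0 := by
      have := P.q₁_lt_q₀
      exact (mul_pos hb0 (by linarith)).ne'
    rw [weight, ← hb, div_mul_cancel₀ _ this]
  -- By the choice of `weight q`, the numerator minus `weight q * d` vanishes at `v = s = 0`, so its
  -- size is controlled by `v + s`. Against `weight q * h` only a bounded error is needed. `B`
  -- covers both.
  set B := C₁ * (η + 1) + C₁ + P.weight q * b + N₀ + P.weight q * P.q₀ with hB
  have hN₀0 : 0 < N₀ := mul_pos (P.q₁_pos.trans_le hq.1)
    (Real.rpow_pos_of_pos (temp_pos le_rfl hq.2) _)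
  have hq₀ := P.q₀_pos
  have hB0 : 0 ≤ B := by positivity
  refine ⟨B / k * (η + 1) + P.weight q * (|Real.log η| + |Real.log (η + 1)|), fun s hs => ?_⟩
  have hs0 := hs.1
  have hmain := abs_integral_sub_log_le (F := fun v => P.dist s (q + σ * v)) (c := P.weight q)
    (A := B / k) hη.le hs.1 (by positivity) ?_ ?_
  · have hl1 : Real.log η ≤ Real.log (η + s) := Real.log_le_log hη (by linarith)
    have hl2 : Real.log (η + s) ≤ Real.log (η + 1) :=
      Real.log_le_log (by linarith) (by linarith [hs.2])
    have hl3 : |Real.log (η + s)| ≤ |Real.log η| + |Real.log (η + 1)| := by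
      have := neg_abs_le (Real.log η)
      have := le_abs_self (Real.log (η + 1))
      have := abs_nonneg (Real.log η)
      have := abs_nonneg (Real.log (η + 1))
      exact abs_le.2 ⟨by linarith, by linarith⟩
    have e : (∫ v in 0..η, P.dist s (q + σ * v)) - P.weight q * -Real.log s =
        ((∫ v in 0..η, P.dist s (q + σ * v)) - P.weight q * (Real.log (η + s) - Real.log s))
        + P.weight q * Real.log (η + s) := by ring
    rw [e]
    refine (abs_add_le _ _).trans (add_le_add hmain ?_)
    rw [abs_mul, abs_of_pos hw]
    gcongr
  · refine ContinuousOn.intervalIntegrable ?_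
    rw [uIcc_of_le hη.le]
    exact (continuousOn_dist_right hs.1).comp (by fun_prop) hmem
  · intro v hv
    have hm := hmem v hv
    have hdrop : P.drop s (q + σ * v) =
        v * (b * (P.q₀ - P.q₁ - v)) + s * P.h (q + σ * v) := by
      rw [drop, ← hb, mul_assoc, hfac]; ring
    have hx := hN s ⟨hs.1.le, hs.2⟩ _ hm q hq
    have habs : |q + σ * v - q| = v := by
      rw [add_sub_cancel_left, abs_mul, hσ, one_mul, abs_of_nonneg hv.1]
    rw [habs, ← hN₀] at hx
    have hNc := abs_le.1 hx
    have hvη := hv.2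
    have hv0 := hv.1
    have hs1 := hs.2
    rw [dist, hdrop]
    refine abs_div_sub_div_le hk0 hv.1 hs.1 ?_ ?_ ?_ ?_
    · exact (min_le_left _ _).trans (mul_le_mul_of_nonneg_left (by linarith) hb0.le)
    · exact (min_le_right _ _).trans (h_mono hm.1)
    · have e : (q + σ * v) * P.temp s (q + σ * v) ^ P.δ - P.weight q * (b * (P.q₀ - P.q₁ - v)) =
          ((q + σ * v) * P.temp s (q + σ * v) ^ P.δ - N₀) + P.weight q * b * v := by
        rw [hN₀c]; ring
      rw [e]
      refine (abs_add_le _ _).trans ?_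
      rw [abs_of_nonneg (show 0 ≤ P.weight q * b * v by positivity)]
      have h5 : P.weight q * b * v ≤ P.weight q * b * (v + s) :=
        mul_le_mul_of_nonneg_left (by linarith) (by positivity)
      have h6 : (C₁ + P.weight q * b) * (v + s) ≤ B * (v + s) := by
        refine mul_le_mul_of_nonneg_right ?_ (by linarith)
        have : 0 ≤ C₁ * (η + 1) + N₀ + P.weight q * P.q₀ := by positivity
        linarith
      linarith
    · have hh0 := (P.h_pos hm.1).le
      have hh1 := P.h_le hm.2
      have h7 : C₁ * (v + s) ≤ C₁ * (η + 1) := by gcongr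
      have h8 : P.weight q * P.h (q + σ * v) ≤ P.weight q * P.q₀ := by gcongr
      have h9 : 0 ≤ P.weight q * P.h (q + σ * v) := by positivity
      have h10 : 0 ≤ P.weight q * b := by positivity
      have h11 : 0 ≤ C₁ * (η + 1) := by positivity
      have h12 : 0 ≤ P.weight q * P.q₀ := by positivity
      exact abs_le.2 ⟨by linarith, by linarith⟩

lemma exists_log_asymp_q₀ (h1 : P.q₁ < u) (h2 : u < P.q₀) : ∃ C : ℝ, ∀ s ∈ Ioc (0 : ℝ) 1,
    |(∫ w in u..P.q₀, P.dist s w) - P.weight P.q₀ * -Real.log s| ≤ C := by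
  obtain ⟨C, hC⟩ := P.exists_log_asymp (q := P.q₀) (σ := -1) (η := P.q₀ - u)
    ⟨P.q₁_lt_q₀.le, le_rfl⟩ (by simp) (by linarith) (by linarith)
    (fun v hv => ⟨by linarith [hv.2], by linarith [hv.1]⟩) (fun v => by ring)
  refine ⟨C, fun s hs => ?_⟩
  have e := intervalIntegral.integral_comp_sub_left (a := 0) (b := P.q₀ - u) (P.dist s) P.q₀
  rw [sub_sub_cancel, sub_zero] at e
  rw [← e]
  simpa [sub_eq_add_neg] using hC s hs

lemma exists_log_asymp_q₁ (h1 : P.q₁ < u) (h2 : u < P.q₀) : ∃ C : ℝ, ∀ s ∈ Ioc (0 : ℝ) 1,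
    |(∫ w in P.q₁..u, P.dist s w) - P.weight P.q₁ * -Real.log s| ≤ C := by
  obtain ⟨C, hC⟩ := P.exists_log_asymp (q := P.q₁) (σ := 1) (η := u - P.q₁)
    ⟨le_rfl, P.q₁_lt_q₀.le⟩ (by simp) (by linarith) (by linarith)
    (fun v hv => ⟨by linarith [hv.1], by linarith [hv.2]⟩) (fun v => by ring)
  refine ⟨C, fun s hs => ?_⟩
  have e := intervalIntegral.integral_comp_add_left (a := 0) (b := u - P.q₁) (P.dist s) P.q₁
  rw [add_sub_cancel, add_zero] at e
  rw [← e]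
  simpa using hC s hs

lemma tendsto_neg_log : Tendsto (fun s => -Real.log s) (𝓝[>] 0) atTop :=
  tendsto_neg_atBot_atTop.comp Real.tendsto_log_nhdsGT_zero

lemma tendsto_div_log {J : ℝ → ℝ} {c C : ℝ}
    (h : ∀ s ∈ Ioc (0 : ℝ) 1, |J s - c * -Real.log s| ≤ C) :
    Tendsto (fun s => J s / -Real.log s) (𝓝[>] 0) (𝓝 c) := by
  rw [tendsto_iff_norm_sub_tendsto_zero]
  have hl := tendsto_neg_log
  refine squeeze_zero' (g := fun s => C / -Real.log s) (Eventually.of_forall fun s => norm_nonneg _)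
    ?_ (tendsto_const_nhds.div_atTop hl)
  filter_upwards [hl.eventually_gt_atTop 0, Ioc_mem_nhdsGT (zero_lt_one' ℝ)] with s hs hs1
  have : J s / -Real.log s - c = (J s - c * -Real.log s) / -Real.log s := by
    rw [sub_div, mul_div_cancel_right₀ _ hs.ne']
  rw [this, Real.norm_eq_abs, abs_div, abs_of_pos hs]
  gcongr
  exact h s hs1

lemma integral_add_integral (hs : 0 < s) (h1 : P.q₁ ≤ u) (h2 : u ≤ P.q₀) :
    (∫ w in P.q₁..u, P.dist s w) + ∫ w in u..P.q₀, P.dist s w = P.travel s :=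
  intervalIntegral.integral_add_adjacent_intervals (intervalIntegrable_dist hs le_rfl h1 h2)
    (intervalIntegrable_dist hs h1 h2 le_rfl)

variable (P) in
/-- The front selected in the limit. -/
noncomputable def front : ℝ := P.weight P.q₀ / (P.weight P.q₁ + P.weight P.q₀)

/-- Any interior velocity, here the midpoint, separates the two singular ends, and each contributes
its own weight. -/
lemma tendsto_travel_div_log :
    Tendsto (fun s => P.travel s / -Real.log s) (𝓝[>] 0)
      (𝓝 (P.weight P.q₁ + P.weight P.q₀)) := by
  have hlt := P.q₁_lt_q₀
  have h1 : P.q₁ < (P.q₁ + P.q₀) / 2 := by linarith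
  have h2 : (P.q₁ + P.q₀) / 2 < P.q₀ := by linarith
  obtain ⟨C₀, hC₀⟩ := exists_log_asymp_q₀ h1 h2
  obtain ⟨C₁, hC₁⟩ := exists_log_asymp_q₁ h1 h2
  refine ((tendsto_div_log hC₁).add (tendsto_div_log hC₀)).congr' ?_
  filter_upwards [self_mem_nhdsWithin] with s hs
  rw [← add_div, integral_add_integral hs h1.le h2.le]

/-- The fraction of the distance travelled before the velocity has dropped to `u`. -/
lemma tendsto_fraction (h1 : P.q₁ < u) (h2 : u < P.q₀) :
    Tendsto (fun s => (∫ w in u..P.q₀, P.dist s w) / P.travel s) (𝓝[>] 0) (𝓝 P.front) := by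
  obtain ⟨C₀, hC₀⟩ := exists_log_asymp_q₀ h1 h2
  have hw0 := P.weight_pos P.q₁_lt_q₀.le le_rfl
  have hw1 := P.weight_pos le_rfl P.q₁_lt_q₀.le
  -- Moving `u` inside `(q₁, q₀)` changes the integral only by a bounded amount, so the limit does
  -- not depend on `u`. This makes the limiting front sharp.
  refine ((tendsto_div_log hC₀).div P.tendsto_travel_div_log (by positivity)).congr' ?_
  filter_upwards [tendsto_neg_log.eventually_gt_atTop 0] with s hs
  exact div_div_div_cancel_right₀ hs.ne' _ _

lemma tendsto_travel_zero : Tendsto P.travel (𝓝[>] 0) atTop := by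
  have hw0 := P.weight_pos P.q₁_lt_q₀.le le_rfl
  have hw1 := P.weight_pos le_rfl P.q₁_lt_q₀.le
  refine (Tendsto.pos_mul_atTop (by positivity : 0 < P.weight P.q₁ + P.weight P.q₀)
    P.tendsto_travel_div_log tendsto_neg_log).congr' ?_
  filter_upwards [tendsto_neg_log.eventually_gt_atTop 0] with s hs
  exact div_mul_cancel₀ _ hs.ne'

lemma continuousOn_travel : ContinuousOn P.travel (Ioi 0) := by
  intro s₀ hs₀
  have hs₀' : 0 < s₀ := hs₀
  refine ContinuousAt.continuousWithinAt ?_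
  -- Cutting `s` off below at `s₀ / 2` and clamping the velocity makes the integrand jointly
  -- continuous on the whole plane without changing the integral near `s₀`.
  have hc : Continuous fun s => ∫ w in P.q₁..P.q₀, P.dist (max s (s₀ / 2)) (P.clamp w) := by
    refine intervalIntegral.continuous_parametric_intervalIntegral_of_continuous' ?_ _ _
    exact P.continuousOn_dist.comp_continuous
      (f := fun x : ℝ × ℝ => (max x.1 (s₀ / 2), P.clamp x.2))
      (by have := P.continuous_clamp
          fun_prop) fun x => ⟨lt_max_of_lt_right (half_pos hs₀'), clamp_mem _⟩
  refine hc.continuousAt.congr ?_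
  filter_upwards [Ioi_mem_nhds (half_lt_self hs₀')] with s hs
  rw [max_eq_left (le_of_lt hs), integral_clamp le_rfl P.q₁_lt_q₀.le le_rfl, travel]

/-! ### Strict monotonicity of `travel` near `s = 0`. -/

lemma drop_sub_drop : P.drop s' u - P.drop s u = (s' - s) * P.h u := by
  unfold drop; ring

/-- Raising `s` lowers `1 / D` at a rate of order `1 / D²`, while `T^δ` changes only by a Lipschitz
amount, weighted by `1 / D`. The quadratic term dominates up to a constant, so the integrated
inequality gets its sign from the divergence of `travel`. Finite differences avoid differentiating
under the integral. -/
lemma exists_dist_sub_ge : ∃ a : ℝ, 0 < a ∧ ∃ C : ℝ, ∀ s s', 0 < s → s < s' → s' ≤ 1 →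
    ∀ u ∈ Icc P.q₁ P.q₀, (s' - s) * (a * P.dist s' u - C) ≤ P.dist s u - P.dist s' u := by
  obtain ⟨C₁, hC₁, hlip⟩ := P.exists_lipschitz_temp_rpow
  set τ := P.temp 0 P.q₀ with hτ
  have hτ0 : 0 < τ := temp_pos le_rfl le_rfl
  set M := P.temp 1 P.q₁ ^ P.δ with hM
  have hM0 : 0 < M := Real.rpow_pos_of_pos (temp_pos zero_le_one P.q₁_lt_q₀.le) _
  set c := τ ^ P.δ * P.h P.q₁ with hc
  have hc0 : 0 < c := mul_pos (Real.rpow_pos_of_pos hτ0 _) h_q₁_pos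
  have hk := P.factor_pos
  have hδ := P.δ_pos
  have hq₀ := P.q₀_pos
  refine ⟨C₁ / M, by positivity, P.q₀ * (C₁ ^ 2 / c), fun s s' hs hss' hs' u hu => ?_⟩
  have hs'0 : 0 < s' := hs.trans hss'
  have hu0 : 0 < u := P.q₁_pos.trans_le hu.1
  have hD := drop_pos hs hu.1 hu.2
  have hD' := drop_pos hs'0 hu.1 hu.2
  have ht := temp_pos hs.le hu.2
  have ht' := temp_pos hs'0.le hu.2
  have hlo : τ ≤ P.temp s u := by
    unfold τ temp
    have := g_anti hu.2 le_rfl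
    have : 0 ≤ s * (P.q₀ - u) := mul_nonneg hs.le (by linarith [hu.2])
    exact mul_le_mul_of_nonneg_left (by linarith) hk.le
  have hhi : P.temp s' u ≤ P.temp 1 P.q₁ := by
    unfold temp
    have := P.g_anti hu.1 hu.2
    have : s' * (P.q₀ - u) ≤ 1 * (P.q₀ - P.q₁) :=
      mul_le_mul hs' (by linarith [hu.1]) (by linarith [hu.2]) zero_le_one
    exact mul_le_mul_of_nonneg_left (by linarith) hk.le
  set t := P.temp s u ^ P.δ with htd
  set t' := P.temp s' u ^ P.δ with htd'
  have ht0 : 0 < t := Real.rpow_pos_of_pos ht _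
  have hct : c ≤ t * P.h u := by
    have h1 : τ ^ P.δ ≤ t := Real.rpow_le_rpow hτ0.le hlo hδ.le
    exact mul_le_mul h1 (h_mono hu.1) h_q₁_pos.le ht0.le
  have htM : t' ≤ M := Real.rpow_le_rpow ht'.le hhi hδ.le
  have hdiff : t' - t ≤ C₁ * (s' - s) := by
    have := hlip s' ⟨hs'0.le, hs'⟩ s ⟨hs.le, hss'.le.trans hs'⟩ u hu
    rw [abs_of_pos (by linarith : 0 < s' - s)] at this
    exact (le_abs_self _).trans this
  have hDD := P.drop_mono hss'.le hu.1
  set y := (P.drop s' u)⁻¹ with hy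
  set z := (P.drop s u)⁻¹ with hz
  have hy0 : 0 < y := inv_pos.2 hD'
  have hyz : y ≤ z := inv_anti₀ hD hDD
  have hzy : z - y = (s' - s) * P.h u * z * y := by
    rw [← drop_sub_drop, hy, hz]
    field_simp
  have e : P.dist s u - P.dist s' u = u * (t * (z - y) - (t' - t) * y) := by
    rw [dist, dist, div_eq_mul_inv, div_eq_mul_inv]; ring
  have e' : P.dist s' u = u * t' * y := by rw [dist, div_eq_mul_inv]
  have h1 : (s' - s) * (y * (c * y - C₁)) ≤ t * (z - y) - (t' - t) * y := by
    have h2 : (t' - t) * y ≤ C₁ * (s' - s) * y := mul_le_mul_of_nonneg_right hdiff hy0.le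
    have h3 : (s' - s) * y * (c * y) ≤ (s' - s) * y * (t * P.h u * z) :=
      mul_le_mul_of_nonneg_left (mul_le_mul hct hyz hy0.le (hc0.le.trans hct))
        (mul_nonneg (by linarith) hy0.le)
    rw [hzy]
    nlinarith
  -- Completing the square trades the quadratic gain in `y = 1 / D` for a linear one, which is
  -- comparable to `dist` because `t' ≤ M`.
  have h4 : C₁ * y - C₁ ^ 2 / c ≤ y * (c * y - C₁) := by
    have : 0 ≤ c * (y - C₁ / c) ^ 2 := by positivity
    have e2 : c * (y - C₁ / c) ^ 2 = c * y ^ 2 - 2 * C₁ * y + C₁ ^ 2 / c := by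
      field_simp
      ring
    nlinarith
  have h5 : C₁ / M * P.dist s' u - P.q₀ * (C₁ ^ 2 / c) ≤ u * (C₁ * y - C₁ ^ 2 / c) := by
    have h6 : C₁ / M * (u * t' * y) ≤ u * (C₁ * y) := by
      have : C₁ / M * (u * t' * y) = u * (C₁ * y) * (t' / M) := by ring
      rw [this]
      exact mul_le_of_le_one_right (by positivity) (by rwa [div_le_one hM0])
    have h7 : u * (C₁ ^ 2 / c) ≤ P.q₀ * (C₁ ^ 2 / c) :=
      mul_le_mul_of_nonneg_right hu.2 (by positivity)
    rw [e', mul_sub]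
    linarith
  calc (s' - s) * (C₁ / M * P.dist s' u - P.q₀ * (C₁ ^ 2 / c))
      ≤ (s' - s) * (u * (y * (c * y - C₁))) :=
        mul_le_mul_of_nonneg_left (h5.trans (mul_le_mul_of_nonneg_left h4 hu0.le)) (by linarith)
    _ = u * ((s' - s) * (y * (c * y - C₁))) := by ring
    _ ≤ P.dist s u - P.dist s' u := by
        rw [e]
        exact mul_le_mul_of_nonneg_left h1 hu0.le

lemma exists_strictAntiOn_travel : ∃ s₀ : ℝ, 0 < s₀ ∧ StrictAntiOn P.travel (Ioc 0 s₀) := by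
  obtain ⟨a, ha, C, hC⟩ := P.exists_dist_sub_ge
  have hL := P.q₁_lt_q₀
  -- The threshold `s₀` is chosen so that the integral of `a * dist s' - C` is positive for all `s'
  -- ≤ s₀`.
  have hev : ∀ᶠ s in 𝓝[>] (0 : ℝ), s ≤ 1 ∧ C * (P.q₀ - P.q₁) < a * P.travel s := by
    filter_upwards [Ioc_mem_nhdsGT (zero_lt_one' ℝ),
      (P.tendsto_travel_zero.const_mul_atTop ha).eventually_gt_atTop (C * (P.q₀ - P.q₁))]
      with s h1 h2 using ⟨h1.2, h2⟩
  obtain ⟨s₀, hs₀, hsub⟩ := mem_nhdsGT_iff_exists_Ioc_subset.1 hev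
  refine ⟨s₀, hs₀, fun s hs s' hs' hss' => ?_⟩
  obtain ⟨h1, h2⟩ := hsub hs'
  have i1 := intervalIntegrable_dist hs.1 (P := P) le_rfl hL.le le_rfl
  have i2 := intervalIntegrable_dist hs'.1 (P := P) le_rfl hL.le le_rfl
  have key := intervalIntegral.integral_mono_on hL.le
    (((i2.const_mul a).sub intervalIntegrable_const).const_mul (s' - s)) (i1.sub i2)
    (hC s s' hs.1 hss' h1)
  rw [intervalIntegral.integral_const_mul, intervalIntegral.integral_sub (i2.const_mul a)
    intervalIntegrable_const, intervalIntegral.integral_const_mul,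
    intervalIntegral.integral_sub i1 i2, intervalIntegral.integral_const, smul_eq_mul] at key
  have : 0 < (s' - s) * (a * P.travel s' - (P.q₀ - P.q₁) * C) :=
    mul_pos (by linarith) (by linarith)
  change _ ≤ P.travel s - P.travel s' at key
  change (s' - s) * (a * P.travel s' - (P.q₀ - P.q₁) * C) ≤ _ at key
  linarith

/-! ### Behaviour of `travel` for large `s`. -/

variable (P) in
/-- The constant `A` in the bound `drop s u ≤ A s` for `1 ≤ s`. -/
noncomputable def dropBound : ℝ := (P.γ + 1) / 2 * (P.q₀ - P.q₁) ^ 2 + P.q₀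

lemma dropBound_pos : 0 < P.dropBound := by
  have := P.γ_pos
  have := P.q₀_pos
  unfold dropBound
  positivity

lemma drop_le (hs : 1 ≤ s) (h1 : P.q₁ ≤ u) (h2 : u ≤ P.q₀) : P.drop s u ≤ P.dropBound * s := by
  have hγ := P.γ_pos
  have e1 : (P.q₀ - u) * (u - P.q₁) ≤ (P.q₀ - P.q₁) ^ 2 := by
    rw [sq]
    exact mul_le_mul (by linarith) (by linarith) (by linarith) (by linarith)
  have e2 := mul_le_mul_of_nonneg_left e1 (by linarith : 0 ≤ (P.γ + 1) / 2)
  have e3 : (P.γ + 1) / 2 * (P.q₀ - P.q₁) ^ 2 ≤ (P.γ + 1) / 2 * (P.q₀ - P.q₁) ^ 2 * s :=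
    le_mul_of_one_le_right (by positivity) hs
  have e4 := mul_le_mul_of_nonneg_left (P.h_le h2) (by linarith : 0 ≤ s)
  unfold drop dropBound
  linarith

/-- For `s ≥ 1` the temperature is at most `T * s` and `drop` is at least `s * h q₁`, so the
integrand is of order at most `s^(δ-1)`. -/
lemma exists_travel_le : ∃ C : ℝ, 0 < C ∧ ∀ s, 1 ≤ s → P.travel s ≤ C * s ^ (P.δ - 1) := by
  have hk := P.factor_pos
  have hL := P.q₁_lt_q₀
  have hη := P.h_q₁_pos
  have hq₀ := P.q₀_pos
  have hδ := P.δ_pos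
  set T := (P.γ - 1) / P.R * (P.g P.q₁ + (P.q₀ - P.q₁)) with hT
  have hT0 : 0 < T := mul_pos hk (add_pos (g_pos hL.le) (by linarith))
  refine ⟨(P.q₀ - P.q₁) * (P.q₀ * T ^ P.δ / P.h P.q₁),
    mul_pos (by linarith) (by positivity), fun s hs => ?_⟩
  have hs0 : 0 < s := by linarith
  have hpt : ∀ u ∈ Icc P.q₁ P.q₀,
      P.dist s u ≤ P.q₀ * T ^ P.δ / P.h P.q₁ * s ^ (P.δ - 1) := by
    intro u hu
    have ht : P.temp s u ≤ T * s := by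
      unfold temp
      rw [hT, mul_assoc]
      refine mul_le_mul_of_nonneg_left ?_ hk.le
      have h1 := P.g_anti hu.1 hu.2
      have h2 : P.g P.q₁ ≤ P.g P.q₁ * s := le_mul_of_one_le_right (g_pos hL.le).le hs
      have h3 := mul_le_mul_of_nonneg_left (sub_le_sub_left hu.1 P.q₀) hs0.le
      linarith
    have ht2 : P.temp s u ^ P.δ ≤ T ^ P.δ * s ^ P.δ := by
      rw [← Real.mul_rpow hT0.le hs0.le]
      exact Real.rpow_le_rpow (temp_pos hs0.le hu.2).le ht hδ.le
    have hu0 : 0 < u := P.q₁_pos.trans_le hu.1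
    calc P.dist s u ≤ P.q₀ * (T ^ P.δ * s ^ P.δ) / (s * P.h P.q₁) := by
          unfold dist
          have := drop_ge hs0.le hu.1 hu.2
          have := Real.rpow_nonneg (temp_pos hs0.le hu.2).le P.δ
          have := hu.2
          gcongr
      _ = _ := by
          rw [Real.rpow_sub_one hs0.ne']
          field_simp
  have key := intervalIntegral.integral_mono_on hL.le
    (intervalIntegrable_dist hs0 (P := P) le_rfl hL.le le_rfl) intervalIntegrable_const hpt
  rw [intervalIntegral.integral_const, smul_eq_mul, ← mul_assoc] at key
  exact key

/-- Lower bound for the distance travelled at velocities below `u`. -/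
lemma exists_le_integral (h1 : P.q₁ < u) (h2 : u < P.q₀) : ∃ c : ℝ, 0 < c ∧ ∀ s, 1 ≤ s →
    c * s ^ (P.δ - 1) ≤ ∫ w in P.q₁..u, P.dist s w := by
  have hk := P.factor_pos
  have hA := P.dropBound_pos
  have hδ := P.δ_pos
  have hq₁ := P.q₁_pos
  set T := (P.γ - 1) / P.R * (P.q₀ - u) with hT
  have hT0 : 0 < T := mul_pos hk (by linarith)
  refine ⟨(u - P.q₁) * (P.q₁ * T ^ P.δ / P.dropBound),
    mul_pos (by linarith) (by positivity), fun s hs => ?_⟩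
  have hs0 : 0 < s := by linarith
  have hpt : ∀ w ∈ Icc P.q₁ u,
      P.q₁ * T ^ P.δ / P.dropBound * s ^ (P.δ - 1) ≤ P.dist s w := by
    intro w hw
    have hw2 : w ≤ P.q₀ := hw.2.trans h2.le
    have ht : T * s ≤ P.temp s w := by
      unfold temp
      rw [hT, mul_assoc]
      refine mul_le_mul_of_nonneg_left ?_ hk.le
      have e1 := (P.g_pos hw2).le
      have e3 := mul_le_mul_of_nonneg_left (sub_le_sub_left hw.2 P.q₀) hs0.le
      linarith
    have ht2 : T ^ P.δ * s ^ P.δ ≤ P.temp s w ^ P.δ := by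
      rw [← Real.mul_rpow hT0.le hs0.le]
      exact Real.rpow_le_rpow (by positivity) ht hδ.le
    calc _ = P.q₁ * (T ^ P.δ * s ^ P.δ) / (P.dropBound * s) := by
          rw [Real.rpow_sub_one hs0.ne']
          field_simp
      _ ≤ P.dist s w := by
          unfold dist
          have := drop_le hs hw.1 hw2
          have := drop_pos hs0 hw.1 hw2
          have hw0 : 0 < w := hq₁.trans_le hw.1
          have := Real.rpow_nonneg (temp_pos hs0.le hw2).le P.δ
          have := hw.1
          gcongr
  have key := intervalIntegral.integral_mono_on h1.le intervalIntegrable_const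
    (intervalIntegrable_dist hs0 (P := P) le_rfl h1.le h2.le) hpt
  rw [intervalIntegral.integral_const, smul_eq_mul, ← mul_assoc] at key
  exact key

lemma tendsto_travel_atTop (hδ : 1 < P.δ) : Tendsto P.travel atTop atTop := by
  have hlt := P.q₁_lt_q₀
  have h1 : P.q₁ < (P.q₁ + P.q₀) / 2 := by linarith
  have h2 : (P.q₁ + P.q₀) / 2 < P.q₀ := by linarith
  obtain ⟨c, hc, hle⟩ := exists_le_integral h1 h2
  refine tendsto_atTop_mono' _ ?_
    ((tendsto_rpow_atTop (by linarith : 0 < P.δ - 1)).const_mul_atTop hc)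
  filter_upwards [eventually_ge_atTop 1] with s hs
  have hs0 : 0 < s := by linarith
  rw [← integral_add_integral hs0 h1.le h2.le]
  have : 0 ≤ ∫ w in (P.q₁ + P.q₀) / 2..P.q₀, P.dist s w :=
    intervalIntegral.integral_nonneg h2.le fun w hw =>
      (dist_pos hs0 (h1.le.trans hw.1) hw.2).le
  linarith [hle s hs]

/-- With `w = g u + s * (q₀ - u)`, the numerator has relative growth `δ (q₀ - u) / w` in `s`, and
`drop` at most `1 / s`. The former wins once `(δ - 1) w ≥ δ g`. Where `w` is small, in particular at
`u = q₀`, `dist` may decrease, but only by the amount accounted for by `C`; hence monotonicity holds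
only after integration. -/
lemma exists_dist_sub_ge_of_one_lt (hδ : 1 < P.δ) : ∃ c : ℝ, 0 < c ∧ ∃ C : ℝ, ∀ s s', 1 ≤ s →
    s < s' → ∀ u ∈ Icc P.q₁ P.q₀,
    (s' - s) / (s * s') * (c * s ^ P.δ * (P.q₀ - u) ^ P.δ - C) ≤ P.dist s' u - P.dist s u := by
  have hk := P.factor_pos
  have hA := P.dropBound_pos
  have hη := P.h_q₁_pos
  have hq₀ := P.q₀_pos
  have hq₁ := P.q₁_pos
  have hδ0 := P.δ_pos
  set κ := ((P.γ - 1) / P.R) ^ P.δ with hκ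
  have hκ0 : 0 < κ := Real.rpow_pos_of_pos hk _
  set G := P.g P.q₁ with hG
  have hG0 : 0 < G := g_pos P.q₁_lt_q₀.le
  have hδ1 : 0 < P.δ - 1 := by linarith
  -- Above `W`, half of `(δ - 1) * w` absorbs `δ * g`; below it, the loss is at most `E`.
  set W := 2 * P.δ * G / (P.δ - 1) with hW
  have hW0 : 0 < W := by positivity
  set E := P.δ * G * W ^ (P.δ - 1) with hE
  have hE0 : 0 < E := by positivity
  set a := P.q₁ * κ * P.h P.q₁ / P.dropBound ^ 2 with ha
  set A := P.q₀ * κ * P.q₀ / P.h P.q₁ ^ 2 with hAA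
  refine ⟨a * ((P.δ - 1) / 2), by positivity, A * E, fun s s' hs hss' u hu => ?_⟩
  have hs0 : 0 < s := by linarith
  have hs'0 : 0 < s' := by linarith
  have hu0 : 0 < u := P.q₁_pos.trans_le hu.1
  have hv : 0 ≤ P.q₀ - u := by linarith [hu.2]
  have hD := drop_pos hs0 hu.1 hu.2
  have hD' := drop_pos hs'0 hu.1 hu.2
  have hg := P.g_pos hu.2
  have hgG : P.g u ≤ G := g_anti hu.1 hu.2
  have hh := P.h_pos hu.1
  set w := P.g u + s * (P.q₀ - u) with hw
  set w' := P.g u + s' * (P.q₀ - u) with hw'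
  have hw0 : 0 < w := by positivity
  have hww : w ≤ w' := by unfold w w'; gcongr
  have hw'0 : 0 < w' := hw0.trans_le hww
  have hsw : s * (P.q₀ - u) ≤ w := by linarith
  -- Convexity of the power `δ > 1` bounds the increment of `w ^ δ` from below by its tangent at
  -- `s`.
  have htan := rpow_tangent_le hw0 hw'0.le hδ.le
  have hsub : w' - w = (s' - s) * (P.q₀ - u) := by unfold w w'; ring
  rw [hsub] at htan
  have e1 : P.dist s' u - P.dist s u = u * κ *
      (((w' ^ P.δ - w ^ P.δ) * P.drop s u - w ^ P.δ * (P.drop s' u - P.drop s u)) /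
        (P.drop s u * P.drop s' u)) := by
    have t1 : P.temp s u ^ P.δ = κ * w ^ P.δ := by
      rw [temp, ← hw, Real.mul_rpow hk.le hw0.le]
    have t2 : P.temp s' u ^ P.δ = κ * w' ^ P.δ := by
      rw [temp, ← hw', Real.mul_rpow hk.le hw'0.le]
    rw [dist, dist, t1, t2]
    field_simp
    ring
  have hwd : w ^ (P.δ - 1) * w = w ^ P.δ := by
    rw [Real.rpow_sub_one hw0.ne', div_mul_cancel₀ _ hw0.ne']
  have hwd0 : 0 < w ^ (P.δ - 1) := Real.rpow_pos_of_pos hw0 _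
  have hsD : s * P.h u ≤ P.drop s u := by
    unfold drop
    linarith [P.bulk_nonneg hu.1 hu.2]
  have h1 : (s' - s) * P.h u * ((P.δ - 1) * w ^ P.δ - P.δ * P.g u * w ^ (P.δ - 1)) ≤
      (w' ^ P.δ - w ^ P.δ) * P.drop s u - w ^ P.δ * (P.drop s' u - P.drop s u) := by
    rw [drop_sub_drop]
    have hX : 0 ≤ P.δ * w ^ (P.δ - 1) * ((s' - s) * (P.q₀ - u)) :=
      mul_nonneg (by positivity) (mul_nonneg (by linarith) hv)
    have h2 : P.δ * w ^ (P.δ - 1) * ((s' - s) * (P.q₀ - u)) * (s * P.h u) ≤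
        (w' ^ P.δ - w ^ P.δ) * P.drop s u :=
      mul_le_mul (by linarith) hsD (by positivity) (by linarith)
    refine le_trans (le_of_eq ?_) (sub_le_sub_right h2 _)
    rw [← hwd]
    have : s * (P.q₀ - u) = w - P.g u := by rw [hw]; ring
    linear_combination (-(P.δ * w ^ (P.δ - 1) * (s' - s) * P.h u)) * this
  have h2 : (P.δ - 1) / 2 * (s * (P.q₀ - u)) ^ P.δ - E ≤
      (P.δ - 1) * w ^ P.δ - P.δ * P.g u * w ^ (P.δ - 1) := by
    have h3 : (s * (P.q₀ - u)) ^ P.δ ≤ w ^ P.δ :=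
      Real.rpow_le_rpow (by positivity) hsw hδ0.le
    have h3' := mul_le_mul_of_nonneg_left h3 (by positivity : 0 ≤ (P.δ - 1) / 2)
    have h4 : P.δ * P.g u * w ^ (P.δ - 1) ≤ (P.δ - 1) / 2 * w ^ P.δ + E := by
      rcases le_total w W with hwW | hwW
      · have : P.δ * P.g u * w ^ (P.δ - 1) ≤ E := by
          unfold E
          gcongr
        have : 0 ≤ (P.δ - 1) / 2 * w ^ P.δ := by positivity
        linarith
      · have h5 : P.δ * P.g u ≤ (P.δ - 1) / 2 * w := by
          have : (P.δ - 1) / 2 * W = P.δ * G := by rw [hW]; field_simp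
          have := mul_le_mul_of_nonneg_left hwW (by positivity : 0 ≤ (P.δ - 1) / 2)
          have := mul_le_mul_of_nonneg_left hgG hδ0.le
          linarith
        have := mul_le_mul_of_nonneg_right h5 hwd0.le
        rw [← hwd]
        linarith
    linarith
  -- The prefactor has exact order `1 / (s * s')`. Its lower bound goes with the gain and its upper
  -- bound with the loss `E`.
  set Q := u * κ * P.h u / (P.drop s u * P.drop s' u) with hQ
  have hQ0 : 0 < Q := by positivity
  have hQlo : a / (s * s') ≤ Q := by
    have : a / (s * s') =
        P.q₁ * κ * P.h P.q₁ / ((P.dropBound * s) * (P.dropBound * s')) := by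
      rw [ha]; field_simp
    rw [this, hQ]
    have := drop_le hs hu.1 hu.2
    have := drop_le (hs.trans hss'.le) hu.1 hu.2
    have := P.h_mono hu.1
    have := hu.1
    gcongr
  have hQhi : Q ≤ A / (s * s') := by
    have : A / (s * s') = P.q₀ * κ * P.q₀ / ((s * P.h P.q₁) * (s' * P.h P.q₁)) := by
      rw [hAA]; field_simp
    rw [this, hQ]
    have := drop_ge hs0.le hu.1 hu.2
    have := drop_ge hs'0.le hu.1 hu.2
    have := P.h_le hu.2
    have := hu.2
    gcongr
  have hpos : 0 ≤ (P.δ - 1) / 2 * (s * (P.q₀ - u)) ^ P.δ := by positivity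
  calc (s' - s) / (s * s') * (a * ((P.δ - 1) / 2) * s ^ P.δ * (P.q₀ - u) ^ P.δ - A * E)
      = (s' - s) * (a / (s * s') * ((P.δ - 1) / 2 * (s * (P.q₀ - u)) ^ P.δ)
          - A / (s * s') * E) := by
        rw [Real.mul_rpow hs0.le hv]; ring
    _ ≤ (s' - s) * (Q * ((P.δ - 1) / 2 * (s * (P.q₀ - u)) ^ P.δ) - Q * E) := by
        refine mul_le_mul_of_nonneg_left (sub_le_sub ?_ ?_) (by linarith)
        · exact mul_le_mul_of_nonneg_right hQlo hpos
        · exact mul_le_mul_of_nonneg_right hQhi hE0.le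
    _ = (s' - s) * Q * ((P.δ - 1) / 2 * (s * (P.q₀ - u)) ^ P.δ - E) := by ring
    _ ≤ (s' - s) * Q * ((P.δ - 1) * w ^ P.δ - P.δ * P.g u * w ^ (P.δ - 1)) :=
        mul_le_mul_of_nonneg_left h2 (mul_nonneg (by linarith) hQ0.le)
    _ = u * κ * (((s' - s) * P.h u *
          ((P.δ - 1) * w ^ P.δ - P.δ * P.g u * w ^ (P.δ - 1))) /
            (P.drop s u * P.drop s' u)) := by rw [hQ]; ring
    _ ≤ P.dist s' u - P.dist s u := by
        rw [e1]
        gcongr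

lemma exists_strictMonoOn_travel (hδ : 1 < P.δ) :
    ∃ S : ℝ, 1 ≤ S ∧ StrictMonoOn P.travel (Ici S) := by
  obtain ⟨c, hc, C, hC⟩ := P.exists_dist_sub_ge_of_one_lt hδ
  have hL := P.q₁_lt_q₀
  have hcont : Continuous fun u => (P.q₀ - u) ^ P.δ :=
    (by fun_prop : Continuous fun u => P.q₀ - u).rpow_const fun _ => Or.inr P.δ_pos.le
  set V := ∫ u in P.q₁..P.q₀, (P.q₀ - u) ^ P.δ with hV
  have hV0 : 0 < V := intervalIntegral.intervalIntegral_pos_of_pos_on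
    (hcont.intervalIntegrable _ _)
    (fun u hu => Real.rpow_pos_of_pos (by linarith [hu.2]) _) hL
  -- After integration the gain is `c * s ^ δ * V`, which eventually exceeds the constant loss.
  have hev := ((tendsto_rpow_atTop P.δ_pos).const_mul_atTop (mul_pos hc hV0)).eventually_gt_atTop
    ((P.q₀ - P.q₁) * C)
  obtain ⟨S, hS⟩ := eventually_atTop.1 (hev.and (eventually_ge_atTop 1))
  refine ⟨max S 1, le_max_right _ _, fun s hs s' hs' hss' => ?_⟩
  obtain ⟨h1, h2⟩ := hS s ((le_max_left _ _).trans hs)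
  have hs0 : 0 < s := by linarith
  have hs'0 : 0 < s' := by linarith
  have i1 := intervalIntegrable_dist hs0 (P := P) le_rfl hL.le le_rfl
  have i2 := intervalIntegrable_dist hs'0 (P := P) le_rfl hL.le le_rfl
  have i3 : IntervalIntegrable (fun u => c * s ^ P.δ * (P.q₀ - u) ^ P.δ) volume P.q₁ P.q₀ :=
    (hcont.intervalIntegrable _ _).const_mul _
  have key := intervalIntegral.integral_mono_on hL.le
    ((i3.sub intervalIntegrable_const).const_mul ((s' - s) / (s * s'))) (i2.sub i1)
    (hC s s' h2 hss')
  rw [intervalIntegral.integral_const_mul, intervalIntegral.integral_sub i3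
    intervalIntegrable_const, intervalIntegral.integral_const_mul,
    intervalIntegral.integral_sub i2 i1, intervalIntegral.integral_const, smul_eq_mul, ← hV] at key
  change _ ≤ P.travel s' - P.travel s at key
  have : 0 < (s' - s) / (s * s') * (c * s ^ P.δ * V - (P.q₀ - P.q₁) * C) :=
    mul_pos (div_pos (by linarith) (by positivity)) (by linarith)
  linarith

lemma exists_travel_le_on_Icc {a b : ℝ} (ha : 0 < a) :
    ∃ C : ℝ, ∀ s ∈ Icc a b, P.travel s ≤ C := by
  obtain ⟨C, hC⟩ := isCompact_Icc.bddAbove_image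
    (P.continuousOn_travel.mono fun s (hs : s ∈ Icc a b) => ha.trans_le hs.1)
  exact ⟨C, fun s hs => hC (mem_image_of_mem _ hs)⟩

lemma exists_travel_le_on_Ici (hδ : P.δ ≤ 1) {a : ℝ} (ha : 0 < a) :
    ∃ C : ℝ, ∀ s, a ≤ s → P.travel s ≤ C := by
  obtain ⟨C₁, hC₁⟩ := P.exists_travel_le_on_Icc (b := 1) ha
  obtain ⟨C₂, hC₂, h⟩ := P.exists_travel_le
  refine ⟨max C₁ C₂, fun s hs => ?_⟩
  rcases le_total s 1 with h1 | h1
  · exact (hC₁ s ⟨hs, h1⟩).trans (le_max_left _ _)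
  · refine (h s h1).trans (le_trans ?_ (le_max_right _ _))
    exact mul_le_of_le_one_right hC₂.le (Real.rpow_le_one_of_one_le_of_nonpos h1 (by linarith))

end Params

/-! ### Construction of the flow with a given stress parameter. -/

namespace Params

variable {P : Params} {s s' u x μ : ℝ}

variable (P) in
/-- Minus the distance travelled from velocity `q₀` to velocity `u`, for `m = μ`; the integrand is
extended by constants outside `[q₁, q₀]`. -/
noncomputable def reach (s u : ℝ) : ℝ := ∫ w in P.q₀..u, P.dist s (P.clamp w)

variable (P) in
/-- The velocity profile with stress parameter `s`. -/
noncomputable def profile (s x : ℝ) : ℝ := Function.invFun (P.reach s) (-(x * P.travel s))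

lemma hasDerivAt_reach (hs : 0 < s) (u : ℝ) :
    HasDerivAt (P.reach s) (P.dist s (P.clamp u)) u :=
  (continuous_dist_clamp hs).integral_hasStrictDerivAt _ _ |>.hasDerivAt

lemma strictMono_reach (hs : 0 < s) : StrictMono (P.reach s) :=
  strictMono_of_deriv_pos fun u => by
    rw [(hasDerivAt_reach hs u).deriv]; exact dist_clamp_pos hs u

lemma continuous_reach (hs : 0 < s) : Continuous (P.reach s) :=
  continuous_iff_continuousAt.2 fun u => (hasDerivAt_reach hs u).continuousAt

lemma reach_q₀ : P.reach s P.q₀ = 0 := intervalIntegral.integral_same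

lemma reach_eq (h1 : P.q₁ ≤ u) (h2 : u ≤ P.q₀) :
    P.reach s u = -∫ w in u..P.q₀, P.dist s w := by
  rw [reach, intervalIntegral.integral_symm, integral_clamp h1 h2 le_rfl]

lemma reach_q₁ : P.reach s P.q₁ = -P.travel s := reach_eq le_rfl P.q₁_lt_q₀.le

/-- Clamping keeps the slope of `reach` above its positive minimum over `[q₁, q₀]`, so `reach` grows
at least linearly in both directions. -/
lemma surjective_reach (hs : 0 < s) : Function.Surjective (P.reach s) := by
  obtain ⟨w, hwm, hw⟩ := isCompact_Icc.exists_isMinOn (nonempty_Icc.2 P.q₁_lt_q₀.le)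
    (continuousOn_dist_right (P := P) hs)
  set c := P.dist s w
  have hc0 : 0 < c := dist_pos hs hwm.1 hwm.2
  have hmono : Monotone fun u => P.reach s u - c * u := by
    refine monotone_of_deriv_nonneg (fun u =>
      ((hasDerivAt_reach hs u).sub ((hasDerivAt_id u).const_mul c)).differentiableAt) fun u => ?_
    change 0 ≤ deriv (fun u => P.reach s u - c * id u) u
    rw [((hasDerivAt_reach hs u).fun_sub ((hasDerivAt_id u).const_mul c)).deriv]
    have : c ≤ P.dist s (P.clamp u) := hw (clamp_mem u)
    linarith
  refine (continuous_reach hs).surjective ?_ ?_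
  · refine tendsto_atTop_mono' atTop ?_ (tendsto_atTop_add_const_right _
      (P.reach s 0 - c * 0) (tendsto_id.const_mul_atTop hc0))
    filter_upwards [eventually_ge_atTop 0] with u hu
    have := hmono hu
    simp only [id] at *
    linarith
  · refine tendsto_atBot_mono' atBot ?_ (tendsto_atBot_add_const_right _
      (P.reach s 0 - c * 0) (tendsto_id.const_mul_atBot hc0))
    filter_upwards [eventually_le_atBot 0] with u hu
    have := hmono hu
    simp only [id] at *
    linarith

lemma reach_profile (hs : 0 < s) (x : ℝ) : P.reach s (P.profile s x) = -(x * P.travel s) :=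
  Function.invFun_eq (surjective_reach hs _)

lemma profile_eq (hs : 0 < s) (h : P.reach s u = -(x * P.travel s)) : P.profile s x = u :=
  (strictMono_reach hs).injective ((reach_profile hs x).trans h.symm)

lemma profile_zero (hs : 0 < s) : P.profile s 0 = P.q₀ := profile_eq hs (by simp [reach_q₀])

lemma profile_one (hs : 0 < s) : P.profile s 1 = P.q₁ := profile_eq hs (by simp [reach_q₁])

lemma profile_mem (hs : 0 < s) (hx : x ∈ Icc (0 : ℝ) 1) : P.profile s x ∈ Icc P.q₁ P.q₀ := by
  have ht := travel_pos (P := P) hs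
  constructor
  · rw [← (strictMono_reach hs).le_iff_le, reach_profile hs, reach_q₁]
    nlinarith [hx.2]
  · rw [← (strictMono_reach hs).le_iff_le, reach_profile hs, reach_q₀]
    nlinarith [hx.1]

lemma continuous_profile (hs : 0 < s) : Continuous (P.profile s) := by
  have e : P.profile s = fun x => ((strictMono_reach (P := P) hs).orderIsoOfSurjective _
      (surjective_reach hs)).symm (-(x * P.travel s)) := by
    funext x
    refine profile_eq hs ?_
    exact ((strictMono_reach (P := P) hs).orderIsoOfSurjective _
      (surjective_reach hs)).apply_symm_apply _
  rw [e]
  exact (OrderIso.continuous _).comp (by fun_prop)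

lemma hasDerivAt_profile (hs : 0 < s) (x : ℝ) :
    HasDerivAt (P.profile s) (-(P.travel s / P.dist s (P.clamp (P.profile s x)))) x := by
  have ht := travel_pos (P := P) hs
  have h1 := (hasDerivAt_reach (P := P) hs (P.profile s x)).const_mul (-(P.travel s)⁻¹)
  have h2 := HasDerivAt.of_local_left_inverse (continuous_profile hs).continuousAt h1
    (mul_ne_zero (neg_ne_zero.2 (inv_ne_zero ht.ne')) (dist_clamp_pos hs _).ne')
    (Eventually.of_forall fun y => by
      rw [reach_profile hs]
      field_simp)
  refine h2.congr_deriv ?_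
  rw [mul_inv, neg_inv, inv_inv, div_eq_mul_inv]
  ring

/-- The derivative of the profile, in the form given by the reduced equation. -/
lemma hasDerivAt_profile' (hs : 0 < s) (hx : x ∈ Icc (0 : ℝ) 1) :
    HasDerivAt (P.profile s) (-(P.travel s * P.drop s (P.profile s x) /
      (P.profile s x * P.temp s (P.profile s x) ^ P.δ))) x := by
  have hm := profile_mem (P := P) hs hx
  refine (hasDerivAt_profile hs x).congr_deriv ?_
  rw [clamp_of_mem hm.1 hm.2, dist, div_div_eq_mul_div]

/-- A bootstrap: the inverse function theorem gives a `C¹` profile, and the reduced equation then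
writes its derivative as a `C¹` function of the profile. The second step is confined to `[0, 1]`,
where the clamp is inactive. -/
lemma contDiffOn_profile (hs : 0 < s) : ContDiffOn ℝ 2 (P.profile s) (Icc 0 1) := by
  have hv1 : ContDiff ℝ 1 (P.profile s) := by
    rw [contDiff_one_iff_deriv]
    refine ⟨fun x => (hasDerivAt_profile hs x).differentiableAt, ?_⟩
    rw [funext fun x => (hasDerivAt_profile (P := P) hs x).deriv]
    exact (continuous_const.div ((continuous_dist_clamp hs).comp (continuous_profile hs))
      fun x => (dist_clamp_pos hs _).ne').neg
  rw [show (2 : WithTop ℕ∞) = 1 + 1 by norm_num,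
    contDiffOn_succ_iff_derivWithin (uniqueDiffOn_Icc zero_lt_one)]
  refine ⟨hv1.differentiable_one.differentiableOn, by simp, ?_⟩
  have e : EqOn (derivWithin (P.profile s) (Icc 0 1)) (fun x => -(P.travel s *
      P.drop s (P.profile s x) / (P.profile s x * P.temp s (P.profile s x) ^ P.δ)))
      (Icc 0 1) := fun x hx =>
    (hasDerivAt_profile' hs hx).hasDerivWithinAt.derivWithin (uniqueDiffOn_Icc zero_lt_one x hx)
  refine ContDiffOn.congr ?_ e
  have hvp : ∀ x ∈ Icc (0 : ℝ) 1, 0 < P.profile s x := fun x hx =>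
    P.q₁_pos.trans_le (profile_mem hs hx).1
  have htp : ∀ x ∈ Icc (0 : ℝ) 1, 0 < P.temp s (P.profile s x) := fun x hx =>
    temp_pos hs.le (profile_mem hs hx).2
  have hd : ContDiff ℝ 1 fun x => P.drop s (P.profile s x) := by
    unfold drop h; fun_prop
  have ht : ContDiff ℝ 1 fun x => P.temp s (P.profile s x) := by
    unfold temp g; fun_prop
  exact ((contDiff_const.mul hd).contDiffOn.div (hv1.contDiffOn.mul
    (ht.contDiffOn.rpow_const_of_ne fun x hx => (htp x hx).ne')) fun x hx =>
      (mul_pos (hvp x hx) (Real.rpow_pos_of_pos (htp x hx) _)).ne').neg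

variable (P) in
/-- The gas state with velocity `v` on the trajectory with stress parameter `s`. -/
noncomputable def state (s v : ℝ) : GasState :=
  ⟨v, P.m / v, (P.γ - 1) * P.m * (P.g v + s * (P.q₀ - v)) / v⟩

variable (P) in
/-- The viscous flow with stress parameter `s`. -/
noncomputable def flow (s x : ℝ) : GasState := P.state s (P.profile s x)

lemma state_isPhysical (hs : 0 ≤ s) (hv : 0 < u) (hv2 : u ≤ P.q₀) : (P.state s u).IsPhysical := by
  have := P.m_pos
  have := P.one_lt_γ
  have := P.g_pos hv2
  exact ⟨by simp only [state]; positivity, div_pos (mul_pos (mul_pos (by linarith) P.m_pos)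
    (add_pos_of_pos_of_nonneg this (mul_nonneg hs (by linarith)))) hv⟩

lemma temperature_state (hv : u ≠ 0) : temperature P.R (P.state s u) = P.temp s u := by
  have := P.m_pos.ne'
  have := P.R_pos.ne'
  simp only [temperature, state, temp]
  field_simp

lemma massFlux_state (hv : u ≠ 0) : massFlux (P.state s u) = P.m := by
  simp only [massFlux, state]; field_simp

/-- Together with `energyFlux_state` this reduces two equations to one: the fluxes differ from
constants by `-m D / u` and `-m D`, in the same ratio `u` as the viscous terms `T^δ u'` and `T^δ u
u'`. -/
lemma momentumFlux_state (hv : u ≠ 0) : momentumFlux (P.state s u) =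
    P.m * ((P.γ + 1) / (2 * P.γ) * (P.q₀ + P.q₁) + s) - P.m * P.drop s u / u := by
  have h1 := P.one_lt_γ
  have h4 : P.γ ≠ 0 := by linarith
  have h3 : P.γ - 1 ≠ 0 := by linarith
  simp only [momentumFlux, state, g, drop, h]
  field_simp
  ring

lemma energyFlux_state (hv : u ≠ 0) : energyFlux P.γ (P.state s u) =
    P.m * ((P.γ + 1) / (2 * (P.γ - 1)) * P.q₀ * P.q₁ + s * P.q₀) - P.m * P.drop s u := by
  have h1 := P.one_lt_γ
  have h3 : P.γ - 1 ≠ 0 := by linarith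
  have h4 : P.γ ≠ 0 := by linarith
  have := P.m_pos.ne'
  simp only [energyFlux, bernoulliFunction, internalEnergy, state, g, drop, h]
  field_simp
  ring

lemma flow_isViscousShockSolution (hs : 0 < s) (hμ : μ * P.travel s = P.m)
    {U₀ U₁ : GasState} (h0 : P.state 0 P.q₀ = U₀) (h1 : U₁.u = P.q₁) :
    IsViscousShockSolution P.γ P.R P.δ μ U₀ U₁ (P.flow s) := by
  have hmem : ∀ {x : ℝ}, x ∈ Icc (0 : ℝ) 1 → P.profile s x ∈ Icc P.q₁ P.q₀ := profile_mem hs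
  have hpos : ∀ {x : ℝ}, x ∈ Icc (0 : ℝ) 1 → 0 < P.profile s x := fun hx =>
    P.q₁_pos.trans_le (hmem hx).1
  have hc := contDiffOn_profile (P := P) hs
  have hnhds : ∀ {x : ℝ}, x ∈ Ioo (0 : ℝ) 1 → Icc (0 : ℝ) 1 ∈ 𝓝 x := fun hx =>
    Icc_mem_nhds hx.1 hx.2
  -- The profile is scaled to the unit interval and so solves the reduced equation with coefficient
  -- `travel s`; the condition on `μ` turns this into `m / μ`.
  have hder : ∀ {x : ℝ}, x ∈ Icc (0 : ℝ) 1 →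
      μ * (temperature P.R (P.flow s x) ^ P.δ * deriv (fun z => (P.flow s z).u) x) =
        -(P.m * P.drop s (P.profile s x) / P.profile s x) := by
    intro x hx
    have ht := Real.rpow_pos_of_pos (temp_pos hs.le (hmem hx).2) P.δ
    have hv := hpos hx
    change μ * (temperature P.R (P.state s (P.profile s x)) ^ P.δ * deriv (P.profile s) x) = _
    rw [temperature_state hv.ne', (hasDerivAt_profile' hs hx).deriv, ← hμ]
    field_simp
  refine ⟨hc, ?_, ?_, fun x hx => state_isPhysical hs.le (hpos hx) (hmem hx).2, ?_, ?_, ?_, ?_, ?_⟩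
  · exact contDiffOn_const.div hc fun x hx => (hpos hx).ne'
  · refine ContDiffOn.div ?_ hc fun x hx => (hpos hx).ne'
    unfold g
    fun_prop
  · intro x hx
    rw [EventuallyEq.deriv_eq (f := fun _ => P.m), deriv_const]
    filter_upwards [hnhds hx] with y hy using massFlux_state (hpos hy).ne'
  · intro x hx
    rw [EventuallyEq.deriv_eq (f := fun y => P.m * ((P.γ + 1) / (2 * P.γ) * (P.q₀ + P.q₁) + s) +
        μ * (temperature P.R (P.flow s y) ^ P.δ * deriv (fun z => (P.flow s z).u) y)),
      deriv_const_add, deriv_const_mul_field]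
    filter_upwards [hnhds hx] with y hy
    rw [hder hy, flow, momentumFlux_state (hpos hy).ne']
    ring
  · intro x hx
    rw [EventuallyEq.deriv_eq (f := fun y =>
        P.m * ((P.γ + 1) / (2 * (P.γ - 1)) * P.q₀ * P.q₁ + s * P.q₀) +
        μ * (temperature P.R (P.flow s y) ^ P.δ * (P.flow s y).u *
          deriv (fun z => (P.flow s z).u) y)),
      deriv_const_add, deriv_const_mul_field]
    filter_upwards [hnhds hx] with y hy
    have e : μ * (temperature P.R (P.flow s y) ^ P.δ * (P.flow s y).u *
          deriv (fun z => (P.flow s z).u) y) = P.profile s y *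
        (μ * (temperature P.R (P.flow s y) ^ P.δ * deriv (fun z => (P.flow s z).u) y)) := by
      change μ * (_ * P.profile s y * _) = _
      ring
    have hy0 := hpos hy
    rw [e, hder hy, flow, energyFlux_state (hpos hy).ne']
    field_simp
    ring
  -- At velocity `q₀` the state does not depend on `s`, because the stress enters through `s * (q₀ -
  -- v)`.
  · rw [flow, profile_zero hs, ← h0]
    simp [state]
  · rw [h1]; exact profile_one hs

/-- At `q₀` the quadratic part of `drop` vanishes and only `s * q₀` remains. Hence `s` can be read
off from the flow, which distinguishes solutions and gives the blow-up of the stress on the second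
branch. -/
lemma entranceStress_flow (hs : 0 < s) (hμ : μ * P.travel s = P.m) :
    entranceStress P.R P.δ μ (P.flow s) = -(P.m * s) := by
  have h0 : (0 : ℝ) ∈ Icc (0 : ℝ) 1 := by simp
  have hv := P.q₀_pos
  have ht := Real.rpow_pos_of_pos (P.temp_pos hs.le le_rfl) P.δ
  have hd : P.drop s P.q₀ = s * P.q₀ := by rw [drop, h_q₀]; ring
  have := (hasDerivAt_profile' (P := P) hs h0).hasDerivWithinAt.derivWithin
    (uniqueDiffOn_Icc zero_lt_one 0 h0)
  change μ * temperature P.R (P.state s (P.profile s 0)) ^ P.δ *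
    derivWithin (P.profile s) (Icc 0 1) 0 = _
  rw [this, profile_zero hs, temperature_state hv.ne', hd, ← hμ]
  field_simp

lemma eq_of_eqOn_flow (hs : 0 < s) (hs' : 0 < s') (hμ : μ * P.travel s = P.m)
    (hμ' : μ * P.travel s' = P.m) (h : EqOn (P.flow s) (P.flow s') (Icc 0 1)) : s = s' := by
  have h1 := entranceStress_flow hs hμ
  have h2 := entranceStress_flow hs' hμ'
  have h0 : (0 : ℝ) ∈ Icc (0 : ℝ) 1 := by simp
  have e : entranceStress P.R P.δ μ (P.flow s) = entranceStress P.R P.δ μ (P.flow s') := by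
    unfold entranceStress
    rw [h h0, derivWithin_congr (fun x hx => by rw [h hx]) (by rw [h h0])]
  rw [h1, h2] at e
  have := P.m_pos
  nlinarith

end Params

/-! ### Every solution is one of the constructed flows. -/

lemma eq_left_of_hasDerivAt_zero {f : ℝ → ℝ} (hc : ContinuousOn f (Icc 0 1))
    (hd : ∀ x ∈ Ioo (0 : ℝ) 1, HasDerivAt f 0 x) {x : ℝ} (hx : x ∈ Icc (0 : ℝ) 1) :
    f x = f 0 := by
  rcases hx.1.eq_or_lt with rfl | h0
  · rfl
  · obtain ⟨c, -, hc'⟩ := exists_hasDerivAt_eq_slope f (fun _ => 0) h0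
      (hc.mono (Icc_subset_Icc_right hx.2)) fun y hy => hd y ⟨hy.1, hy.2.trans_le hx.2⟩
    rw [eq_comm, div_eq_zero_iff] at hc'
    rcases hc' with h | h <;> linarith

namespace Params

variable {P : Params} {s x μ : ℝ}

/-- A velocity field solving the reduced equation with `s > 0` is the profile. -/
lemma eq_profile {u w : ℝ → ℝ} (hμ : 0 < μ) (hs : 0 < s)
    (hw : ∀ x ∈ Icc (0 : ℝ) 1, HasDerivWithinAt u (w x) (Icc 0 1) x)
    (hmem : ∀ x ∈ Icc (0 : ℝ) 1, u x ∈ Icc P.q₁ P.q₀)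
    (hode : ∀ x ∈ Icc (0 : ℝ) 1,
      w x = -(P.m / (μ * P.temp s (u x) ^ P.δ * u x) * P.drop s (u x)))
    (h0 : u 0 = P.q₀) (h1 : u 1 = P.q₁) :
    μ * P.travel s = P.m ∧ EqOn u (P.profile s) (Icc 0 1) := by
  have hcu : ContinuousOn u (Icc 0 1) := fun x hx => (hw x hx).continuousWithinAt
  have key : ∀ x ∈ Icc (0 : ℝ) 1, P.reach s (u x) = -(P.m / μ * x) := by
    intro x hx
    -- Separation of variables gives the first integral `reach s (u x) + (m / μ) x`; its value at `x
    -- = 1` forces `travel s = m / μ`.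
    have := eq_left_of_hasDerivAt_zero (f := fun x => P.reach s (u x) + P.m / μ * x)
      (((continuous_reach hs).comp_continuousOn hcu).add (by fun_prop)) (fun y hy => ?_) hx
    · simp only [h0, reach_q₀, mul_zero, add_zero] at this
      linarith
    · have hy' := Ioo_subset_Icc_self hy
      have hm := hmem y hy'
      have hd := (hw y hy').hasDerivAt (Icc_mem_nhds hy.1 hy.2)
      refine (((hasDerivAt_reach hs (u y)).comp y hd).add
        ((hasDerivAt_id y).const_mul (P.m / μ))).congr_deriv ?_
      have := drop_pos hs hm.1 hm.2
      have := Real.rpow_pos_of_pos (temp_pos hs.le hm.2) P.δ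
      have := P.q₁_pos.trans_le hm.1
      rw [clamp_of_mem hm.1 hm.2, hode y hy', dist]
      field_simp
      ring
  have ht : P.travel s = P.m / μ := by
    have := key 1 (by simp)
    rw [h1, reach_q₁] at this
    linarith
  refine ⟨by rw [ht]; field_simp, fun x hx => (profile_eq hs ?_).symm⟩
  rw [key x hx, ht, mul_comm]

/-- The reduced equation forces a positive stress parameter and velocities in `[q₁, q₀]`. -/
lemma reduced_bounds {u w : ℝ → ℝ} (hμ : 0 < μ)
    (hw : ∀ x ∈ Icc (0 : ℝ) 1, HasDerivWithinAt u (w x) (Icc 0 1) x)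
    (hu : ∀ x ∈ Icc (0 : ℝ) 1, 0 < u x) (hT : ∀ x ∈ Icc (0 : ℝ) 1, 0 < P.temp s (u x))
    (hode : ∀ x ∈ Icc (0 : ℝ) 1,
      w x = -(P.m / (μ * P.temp s (u x) ^ P.δ * u x) * P.drop s (u x)))
    (h0 : u 0 = P.q₀) (h1 : u 1 = P.q₁) :
    0 < s ∧ ∀ x ∈ Icc (0 : ℝ) 1, u x ∈ Icc P.q₁ P.q₀ := by
  have hm := P.m_pos
  have hγ := P.γ_pos
  have hL := P.q₁_lt_q₀
  have hcu : ContinuousOn u (Icc 0 1) := fun x hx => (hw x hx).continuousWithinAt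
  have hright : ∀ x ∈ Ico (0 : ℝ) 1, HasDerivWithinAt u (w x) (Ici x) x := fun x hx =>
    (hw x (Ico_subset_Icc_self hx)).mono_of_mem_nhdsWithin
      (mem_of_superset (Icc_mem_nhdsGE hx.2) (Icc_subset_Icc_left hx.1))
  have hden : ∀ x ∈ Icc (0 : ℝ) 1, 0 < μ * P.temp s (u x) ^ P.δ * u x := fun x hx =>
    mul_pos (mul_pos hμ (Real.rpow_pos_of_pos (hT x hx) _)) (hu x hx)
  have hκ : ∀ x ∈ Icc (0 : ℝ) 1, 0 < P.m / (μ * P.temp s (u x) ^ P.δ * u x) := fun x hx =>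
    div_pos hm (hden x hx)
  -- If `s ≤ 0`, the term `s * h` can only slow the drop, and while `u` is in `[q₁, q₀]` the gap `q₀
  -- - u` grows at a rate at most proportional to itself. Starting from zero it stays below the
  -- barrier `ε * exp (C * x)`, scaled to equal half the jump at `x = 1`, so `q₁` is never reached.
  -- The `+ 1` in `C` makes the barrier inequality strict.
  have hs : 0 < s := by
    by_contra! hs
    have hcκ : ContinuousOn (fun x => P.m / (μ * P.temp s (u x) ^ P.δ * u x)) (Icc 0 1) :=
      continuousOn_const.div ((continuousOn_const.mul
        (((continuous_temp_right s).comp_continuousOn hcu).rpow_const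
          fun x hx => Or.inl (hT x hx).ne')).mul hcu) fun x hx => (hden x hx).ne'
    obtain ⟨K, hK⟩ := isCompact_Icc.bddAbove_image hcκ
    have hK0 : 0 < K := (hκ 0 (by simp)).trans_le (hK (mem_image_of_mem _ (by simp)))
    set C := K * ((P.γ + 1) / 2 * (P.q₀ - P.q₁)) + 1 with hC
    have hC0 : 0 < C := by
      have : 0 < P.q₀ - P.q₁ := by linarith
      positivity
    set ε := (P.q₀ - P.q₁) / 2 * Real.exp (-C) with hε
    have hε0 : 0 < ε := mul_pos (by linarith) (Real.exp_pos _)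
    have hBle : ∀ x ≤ 1, ε * Real.exp (C * x) ≤ (P.q₀ - P.q₁) / 2 := by
      intro x hx
      rw [hε, mul_assoc, ← Real.exp_add]
      refine mul_le_of_le_one_right (by linarith) (Real.exp_le_one_iff.2 ?_)
      nlinarith
    have key := image_le_of_deriv_right_lt_deriv_boundary (f := fun x => P.q₀ - u x)
      (f' := fun x => -w x) (a := 0) (b := 1) (B := fun x => ε * Real.exp (C * x))
      (B' := fun x => ε * (Real.exp (C * x) * (C * 1)))
      (continuousOn_const.sub hcu) (fun x hx => (hright x hx).const_sub _)
      (by simp [h0, hε0.le])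
      (fun x => (((hasDerivAt_id x).const_mul C).exp).const_mul ε) (fun x hx he => by
        have hx' := Ico_subset_Icc_self hx
        have hB := hBle x hx.2.le
        have hB0 : 0 < ε * Real.exp (C * x) := by positivity
        set B := ε * Real.exp (C * x) with hBdef
        have hux : u x = P.q₀ - B := by linarith
        have hh : 0 ≤ P.h (u x) := (h_pos (by linarith)).le
        have hdrop : P.drop s (u x) ≤ (P.γ + 1) / 2 * (P.q₀ - P.q₁) * B := by
          have e1 : P.drop s (u x) = (P.γ + 1) / 2 * B * (P.q₀ - B - P.q₁) + s * P.h (u x) := by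
            rw [drop, hux]; ring
          have e2 := mul_nonpos_of_nonpos_of_nonneg hs hh
          have e3 : (P.γ + 1) / 2 * B * (P.q₀ - B - P.q₁) ≤
              (P.γ + 1) / 2 * B * (P.q₀ - P.q₁) :=
            mul_le_mul_of_nonneg_left (by linarith) (by positivity)
          linarith
        have hd0 : 0 ≤ (P.γ + 1) / 2 * (P.q₀ - P.q₁) * B :=
          mul_nonneg (mul_nonneg (by linarith) (by linarith)) hB0.le
        rw [hode x hx', neg_neg]
        calc P.m / (μ * P.temp s (u x) ^ P.δ * u x) * P.drop s (u x)
            ≤ K * ((P.γ + 1) / 2 * (P.q₀ - P.q₁) * B) :=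
              (mul_le_mul_of_nonneg_left hdrop (hκ x hx').le).trans
                (mul_le_mul_of_nonneg_right (hK (mem_image_of_mem _ hx')) hd0)
          _ < C * B := by rw [hC]; linarith
          _ = ε * (Real.exp (C * x) * (C * 1)) := by rw [hBdef]; ring)
    have h2 := key (show (1 : ℝ) ∈ Icc (0 : ℝ) 1 by simp)
    have h3 := hBle 1 le_rfl
    simp only [h1] at h2
    linarith
  refine ⟨hs, fun x hx => ⟨?_, ?_⟩⟩
  · by_contra! hlt
    -- Slightly below `q₁` the velocity still decreases, so a level `B < q₁` there is a one-way
    -- barrier: once at or below it, `u` cannot return to `q₁` at the exit.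
    have hd : ∀ᶠ v in 𝓝[<] P.q₁, 0 < P.drop s v :=
      nhdsWithin_le_nhds ((continuous_drop_right s).continuousAt.eventually_const_lt
        (drop_pos hs le_rfl hL.le))
    obtain ⟨B, hB, hB1, hB2⟩ := (hd.and (Ico_mem_nhdsLT hlt)).exists
    have := image_le_of_deriv_right_lt_deriv_boundary (f := u) (f' := w) (a := x) (b := 1)
      (B := fun _ => B) (B' := fun _ => 0) (hcu.mono (Icc_subset_Icc_left hx.1))
      (fun y hy => hright y ⟨hx.1.trans hy.1, hy.2⟩) hB1 (fun _ => hasDerivAt_const _ _)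
      (fun y hy he => by
        have hy' : y ∈ Icc (0 : ℝ) 1 := ⟨hx.1.trans hy.1, hy.2.le⟩
        rw [hode y hy', neg_lt_zero]
        exact mul_pos (hκ y hy') (by rwa [he]))
      (right_mem_Icc.2 hx.2)
    linarith
  · refine image_le_of_deriv_right_lt_deriv_boundary (f := u) (f' := w) (a := 0) (b := 1)
      (B := fun _ => P.q₀) (B' := fun _ => 0) hcu hright h0.le (fun _ => hasDerivAt_const _ _)
      (fun y hy he => ?_) hx
    have hy' := Ico_subset_Icc_self hy
    rw [hode y hy', neg_lt_zero]
    exact mul_pos (hκ y hy') (by rw [he]; exact drop_pos hs hL.le le_rfl)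

/-- Recovering a state from its fluxes. -/
lemma eq_state_of_flux {V : GasState} {τ : ℝ} (hρ : 0 < V.ρ) (hmass : massFlux V = P.m)
    (hmom : momentumFlux V = P.m * ((P.γ + 1) / (2 * P.γ) * (P.q₀ + P.q₁) + s) + τ)
    (hen : energyFlux P.γ V =
      P.m * ((P.γ + 1) / (2 * (P.γ - 1)) * P.q₀ * P.q₁ + s * P.q₀) + τ * V.u) :
    0 < V.u ∧ V = P.state s V.u ∧ τ = -(P.m * P.drop s V.u / V.u) := by
  have hu : 0 < V.u := by
    have := P.m_pos
    rw [← hmass, massFlux] at this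
    exact (pos_iff_pos_of_mul_pos this).1 hρ
  have h1 := P.one_lt_γ
  have h3 : P.γ - 1 ≠ 0 := by linarith
  have h4 : P.γ ≠ 0 := by linarith
  have hρm : V.ρ = P.m / V.u := by
    rw [← hmass, massFlux]; field_simp
  have hp : V.p = (P.γ - 1) * P.m * (P.g V.u + s * (P.q₀ - V.u)) / V.u := by
    have e1 : momentumFlux V = P.m * V.u + V.p := by
      rw [momentumFlux, hρm]; field_simp
    have e2 : energyFlux P.γ V = P.m * V.u ^ 2 / 2 + P.γ / (P.γ - 1) * (V.p * V.u) := by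
      have := P.m_pos.ne'
      simp only [energyFlux, bernoulliFunction, internalEnergy, hρm]
      field_simp
      ring
    rw [e1] at hmom
    rw [e2] at hen
    rw [eq_div_iff hu.ne']
    -- Energy minus `u` times momentum eliminates the unknown stress `τ` and determines the
    -- pressure.
    have e3 : V.p * V.u / (P.γ - 1) = P.m * (P.g V.u + s * (P.q₀ - V.u)) := by
      have e4 : P.γ / (P.γ - 1) * (V.p * V.u) = V.p * V.u / (P.γ - 1) + V.p * V.u := by
        field_simp; ring
      rw [e4] at hen
      unfold g
      linear_combination hen - V.u * hmom
    rw [div_eq_iff h3] at e3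
    rw [e3]; ring
  have hV : V = P.state s V.u := by
    ext
    · rfl
    · exact hρm
    · exact hp
  refine ⟨hu, hV, ?_⟩
  have := P.momentumFlux_state (s := s) hu.ne'
  rw [← hV, hmom] at this
  linarith

/-- The flux constants are evaluated at the entrance, where the state is prescribed; only the stress
`α` is unknown, and `s = -α / m`. The fluxes then recover the state, and the scalar equation
determines the velocity. -/
lemma exists_eqOn_flow (hμ : 0 < μ) {U₀ U₁ : GasState} (h0 : P.state 0 P.q₀ = U₀)
    (h1 : U₁.u = P.q₁) {V : ℝ → GasState}
    (hV : IsViscousShockSolution P.γ P.R P.δ μ U₀ U₁ V) :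
    ∃ s : ℝ, 0 < s ∧ μ * P.travel s = P.m ∧ EqOn V (P.flow s) (Icc 0 1) := by
  have hq₀ := P.q₀_pos
  have hm := P.m_pos
  set u : ℝ → ℝ := fun x => (V x).u with hu
  set w := derivWithin u (Icc 0 1) with hw
  set θ : ℝ → ℝ := fun x => temperature P.R (V x) with hθ
  have hcu : ContDiffOn ℝ 2 u (Icc 0 1) := hV.contDiffOn_u
  have hcρ := hV.contDiffOn_ρ
  have hcp := hV.contDiffOn_p
  have hρ : ∀ x ∈ Icc (0 : ℝ) 1, 0 < (V x).ρ := fun x hx => (hV.physical x hx).1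
  have hp : ∀ x ∈ Icc (0 : ℝ) 1, 0 < (V x).p := fun x hx => (hV.physical x hx).2
  have hcw : ContDiffOn ℝ 1 w (Icc 0 1) :=
    hcu.derivWithin (uniqueDiffOn_Icc zero_lt_one) (by norm_num)
  have hcθ : ContDiffOn ℝ 2 θ (Icc 0 1) := by
    unfold θ temperature
    exact hcp.div (contDiffOn_const.mul hcρ) fun x hx => (mul_pos P.R_pos (hρ x hx)).ne'
  have hθ0 : ∀ x ∈ Icc (0 : ℝ) 1, 0 < θ x := fun x hx =>
    div_pos (hp x hx) (mul_pos P.R_pos (hρ x hx))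
  have hcθδ : ContDiffOn ℝ 1 (fun x => θ x ^ P.δ) (Icc 0 1) :=
    (hcθ.of_le (by norm_num)).rpow_const_of_ne fun x hx => (hθ0 x hx).ne'
  have hu1 : ContDiffOn ℝ 1 u (Icc 0 1) := hcu.of_le (by norm_num)
  have hρ1 : ContDiffOn ℝ 1 (fun x => (V x).ρ) (Icc 0 1) := hcρ.of_le (by norm_num)
  have hp1 : ContDiffOn ℝ 1 (fun x => (V x).p) (Icc 0 1) := hcp.of_le (by norm_num)
  have hmassC : ContDiffOn ℝ 1 (fun x => massFlux (V x)) (Icc 0 1) := hρ1.mul hu1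
  have hmomC : ContDiffOn ℝ 1 (fun x => momentumFlux (V x)) (Icc 0 1) :=
    (hρ1.mul (hu1.pow 2)).add hp1
  have henC : ContDiffOn ℝ 1 (fun x => energyFlux P.γ (V x)) (Icc 0 1) := by
    have hq : ContDiffOn ℝ 1 (fun x => (V x).p / (V x).ρ) (Icc 0 1) :=
      hp1.div hρ1 fun x hx => (hρ x hx).ne'
    exact (hρ1.mul hu1).mul (((hu1.pow 2).div_const 2).add ((contDiffOn_const.mul hq).add hq))
  have hτC : ContDiffOn ℝ 1 (fun x => θ x ^ P.δ * w x) (Icc 0 1) := hcθδ.mul hcw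
  have hτuC : ContDiffOn ℝ 1 (fun x => θ x ^ P.δ * u x * w x) (Icc 0 1) :=
    (hcθδ.mul hu1).mul hcw
  have hdiff : ∀ {f : ℝ → ℝ}, ContDiffOn ℝ 1 f (Icc 0 1) → ∀ {x : ℝ}, x ∈ Ioo (0 : ℝ) 1 →
      HasDerivAt f (deriv f x) x := fun hf x hx =>
    ((hf.differentiableOn one_ne_zero).differentiableAt (Icc_mem_nhds hx.1 hx.2)).hasDerivAt
  -- The one-sided derivative `w` agrees with `deriv u` in the interior and is continuous up to the
  -- boundary, so the integrated equations can be evaluated at `x = 0`.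
  have hwd : ∀ {x : ℝ}, x ∈ Ioo (0 : ℝ) 1 → deriv u =ᶠ[𝓝 x] w := fun hx => by
    filter_upwards [Ioo_mem_nhds hx.1 hx.2] with y hy
    exact (derivWithin_of_mem_nhds (Icc_mem_nhds hy.1 hy.2)).symm
  have hmass : ∀ x ∈ Icc (0 : ℝ) 1, massFlux (V x) = massFlux (V 0) := fun x hx =>
    eq_left_of_hasDerivAt_zero hmassC.continuousOn
      (fun y hy => by simpa [hV.mass y hy] using hdiff hmassC hy) hx
  have hmom : ∀ x ∈ Icc (0 : ℝ) 1, momentumFlux (V x) - μ * (θ x ^ P.δ * w x) =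
      momentumFlux (V 0) - μ * (θ 0 ^ P.δ * w 0) := fun x hx =>
    eq_left_of_hasDerivAt_zero (hmomC.sub (contDiffOn_const.mul hτC)).continuousOn
      (fun y hy => by
        have e : deriv (fun y => momentumFlux (V y)) y = μ * deriv (fun x => θ x ^ P.δ * w x) y := by
          rw [hV.momentum y hy]
          congr 1
          refine EventuallyEq.deriv_eq ?_
          filter_upwards [hwd hy] with z hz
          rw [← hz]
        refine ((hdiff hmomC hy).sub ((hdiff hτC hy).const_mul μ)).congr_deriv ?_
        rw [e, sub_self]) hx
  have hen : ∀ x ∈ Icc (0 : ℝ) 1, energyFlux P.γ (V x) - μ * (θ x ^ P.δ * u x * w x) =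
      energyFlux P.γ (V 0) - μ * (θ 0 ^ P.δ * u 0 * w 0) := fun x hx =>
    eq_left_of_hasDerivAt_zero (henC.sub (contDiffOn_const.mul hτuC)).continuousOn
      (fun y hy => by
        have e : deriv (fun y => energyFlux P.γ (V y)) y =
            μ * deriv (fun x => θ x ^ P.δ * u x * w x) y := by
          rw [hV.energy y hy]
          congr 1
          refine EventuallyEq.deriv_eq ?_
          filter_upwards [hwd hy] with z hz
          rw [← hz]
        refine ((hdiff henC hy).sub ((hdiff hτuC hy).const_mul μ)).congr_deriv ?_
        rw [e, sub_self]) hx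
  have hd0 : P.drop 0 P.q₀ = 0 := by simp [drop]
  have hV0 : V 0 = P.state 0 P.q₀ := hV.entrance.trans h0.symm
  have hu0 : u 0 = P.q₀ := by simp only [hu, hV0]; rfl
  set α := μ * (θ 0 ^ P.δ * w 0) with hα
  set s := -(α / P.m) with hs
  have hsα : P.m * s = -α := by rw [hs]; field_simp
  have hstate : ∀ x ∈ Icc (0 : ℝ) 1, 0 < u x ∧ V x = P.state s (u x) ∧
      μ * (θ x ^ P.δ * w x) = -(P.m * P.drop s (u x) / u x) := by
    intro x hx
    refine eq_state_of_flux (hρ x hx) ?_ ?_ ?_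
    · rw [hmass x hx, hV0, massFlux_state hq₀.ne']
    · have := hmom x hx
      rw [hV0, momentumFlux_state hq₀.ne', hd0] at this
      rw [sub_eq_iff_eq_add.1 this]
      linear_combination -hsα
    · have := hen x hx
      rw [hV0, energyFlux_state hq₀.ne', hd0, hu0] at this
      rw [sub_eq_iff_eq_add.1 this]
      change _ = _ + _ * u x
      linear_combination (-P.q₀) * hsα
  have hupos : ∀ x ∈ Icc (0 : ℝ) 1, 0 < u x := fun x hx => (hstate x hx).1
  have hθs : ∀ x ∈ Icc (0 : ℝ) 1, θ x = P.temp s (u x) := fun x hx => by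
    rw [← temperature_state (hupos x hx).ne', ← (hstate x hx).2.1]
  have hT : ∀ x ∈ Icc (0 : ℝ) 1, 0 < P.temp s (u x) := fun x hx => hθs x hx ▸ hθ0 x hx
  have hode : ∀ x ∈ Icc (0 : ℝ) 1,
      w x = -(P.m / (μ * P.temp s (u x) ^ P.δ * u x) * P.drop s (u x)) := by
    intro x hx
    have e := (hstate x hx).2.2
    rw [hθs x hx] at e
    have e1 := Real.rpow_pos_of_pos (hT x hx) P.δ
    have e2 := hupos x hx
    field_simp at e ⊢
    linarith
  have hwder : ∀ x ∈ Icc (0 : ℝ) 1, HasDerivWithinAt u (w x) (Icc 0 1) x := fun x hx =>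
    (hu1.differentiableOn one_ne_zero x hx).hasDerivWithinAt
  have hu1' : u 1 = P.q₁ := hV.exit.trans h1
  obtain ⟨hs0, hmem⟩ := reduced_bounds hμ hwder hupos hT hode hu0 hu1'
  obtain ⟨ht, he⟩ := eq_profile hμ hs0 hwder hmem hode hu0 hu1'
  exact ⟨s, hs0, ht, fun x hx => by rw [(hstate x hx).2.1, he hx, flow]⟩

end Params

/-! ### Convergence on the small-stress branch, divergence on the large-stress branch. -/

lemma tendsto_eLpNorm_one_of_bounded {ι : Type*} {l : Filter ι} [l.IsCountablyGenerated]
    {f : ι → ℝ → ℝ} {g : ℝ → ℝ} {C : ℝ}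
    (hm : ∀ᶠ i in l, Measurable fun x => f i x - g x)
    (hC : ∀ᶠ i in l, ∀ x ∈ Ioo (0 : ℝ) 1, |f i x - g x| ≤ C)
    (hlim : ∀ᵐ x, x ∈ Ioo (0 : ℝ) 1 → Tendsto (fun i => f i x) l (𝓝 (g x))) :
    Tendsto (fun i => eLpNorm (fun x => f i x - g x) 1 (volume.restrict (Ioo 0 1))) l (𝓝 0) := by
  simp only [eLpNorm_one_eq_lintegral_enorm]
  rw [← lintegral_zero (α := ℝ) (μ := volume.restrict (Ioo (0 : ℝ) 1))]
  refine tendsto_lintegral_filter_of_dominated_convergence (fun _ => ENNReal.ofReal C)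
    (hm.mono fun i hi => hi.enorm) ?_ ?_ ?_
  · filter_upwards [hC] with i hi
    filter_upwards [ae_restrict_mem measurableSet_Ioo] with x hx
    rw [← ofReal_norm]
    exact ENNReal.ofReal_le_ofReal (hi x hx)
  · simp
  · filter_upwards [ae_restrict_of_ae hlim, ae_restrict_mem measurableSet_Ioo] with x hx hx'
    have h1 := (hx hx').sub_const (g x)
    rw [sub_self] at h1
    have h2 := (continuous_enorm (E := ℝ)).continuousAt.tendsto.comp h1
    rwa [enorm_zero] at h2

namespace Params

variable {P : Params} {s x u : ℝ}

/-- The profile passes velocity `u` at the fraction of the distance spent above `u`. Limits of these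
fractions thus become pointwise limits of the profile. -/
lemma lt_profile_iff (hs : 0 < s) (h1 : P.q₁ ≤ u) (h2 : u ≤ P.q₀) :
    u < P.profile s x ↔ x < (∫ w in u..P.q₀, P.dist s w) / P.travel s := by
  rw [← (strictMono_reach hs).lt_iff_lt, reach_profile hs, reach_eq h1 h2, neg_lt_neg_iff,
    lt_div_iff₀ (travel_pos hs)]

lemma profile_lt_iff (hs : 0 < s) (h1 : P.q₁ ≤ u) (h2 : u ≤ P.q₀) :
    P.profile s x < u ↔ (∫ w in u..P.q₀, P.dist s w) / P.travel s < x := by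
  rw [← (strictMono_reach hs).lt_iff_lt, reach_profile hs, reach_eq h1 h2, neg_lt_neg_iff,
    div_lt_iff₀ (travel_pos hs)]

lemma tendsto_profile_q₀ (hx : x ∈ Ioo (0 : ℝ) 1) (hxX : x < P.front) :
    Tendsto (fun s => P.profile s x) (𝓝[>] 0) (𝓝 P.q₀) := by
  refine tendsto_order.2 ⟨fun a ha => ?_, fun a ha => ?_⟩
  · obtain ⟨b, hb1, hb2⟩ := exists_between (max_lt ha P.q₁_lt_q₀)
    have hb3 : P.q₁ < b := (le_max_right _ _).trans_lt hb1
    filter_upwards [(tendsto_fraction hb3 hb2).eventually_const_lt hxX,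
      self_mem_nhdsWithin] with s h1 hs
    exact ((le_max_left _ _).trans_lt hb1).trans ((lt_profile_iff hs hb3.le hb2.le).2 h1)
  · filter_upwards [self_mem_nhdsWithin] with s hs
    exact (profile_mem hs (Ioo_subset_Icc_self hx)).2.trans_lt ha

lemma tendsto_profile_q₁ (hx : x ∈ Ioo (0 : ℝ) 1) (hxX : P.front < x) :
    Tendsto (fun s => P.profile s x) (𝓝[>] 0) (𝓝 P.q₁) := by
  refine tendsto_order.2 ⟨fun a ha => ?_, fun a ha => ?_⟩
  · filter_upwards [self_mem_nhdsWithin] with s hs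
    exact ha.trans_le (profile_mem hs (Ioo_subset_Icc_self hx)).1
  · obtain ⟨b, hb1, hb2⟩ := exists_between (lt_min ha P.q₁_lt_q₀)
    have hb3 : b < P.q₀ := hb2.trans_le (min_le_right _ _)
    filter_upwards [(tendsto_fraction hb1 hb3).eventually_lt_const hxX,
      self_mem_nhdsWithin] with s h1 hs
    exact ((profile_lt_iff hs hb1.le hb3.le).2 h1).trans (hb2.trans_le (min_le_left _ _))

lemma state_p_mem (hs : s ∈ Icc (0 : ℝ) 1) (hu : u ∈ Icc P.q₁ P.q₀) :
    (P.state s u).p ∈ Icc 0 ((P.γ - 1) * P.m * (P.g P.q₁ + 1 * (P.q₀ - P.q₁)) / P.q₁) := by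
  have hq₁ := P.q₁_pos
  have hu0 : 0 < u := hq₁.trans_le hu.1
  have hγ : 0 < P.γ - 1 := by linarith [P.one_lt_γ]
  have hm := P.m_pos
  refine ⟨(state_isPhysical hs.1 hu0 hu.2).2.le, ?_⟩
  have h1 := P.g_anti hu.1 hu.2
  have h2 := P.g_pos hu.2
  have h3 := hu.1
  have h4 : 0 ≤ P.q₀ - u := by linarith [hu.2]
  have h5 := hs.1
  have h6 := hs.2
  have h7 : 0 ≤ P.g P.q₁ + 1 * (P.q₀ - P.q₁) := by linarith [P.q₁_lt_q₀]
  simp only [state]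
  gcongr

lemma state_ρ_mem (hu : u ∈ Icc P.q₁ P.q₀) : (P.state s u).ρ ∈ Icc 0 (P.m / P.q₁) := by
  have hq₁ := P.q₁_pos
  have hm := P.m_pos
  have hu0 : 0 < u := hq₁.trans_le hu.1
  have := hu.1
  refine ⟨by simp only [state]; positivity, ?_⟩
  simp only [state]
  gcongr

/-- The states of the inviscid shock on the two sides of the front. -/
lemma normalShock_state (X x : ℝ) : ∃ q ∈ Icc P.q₁ P.q₀,
    normalShock (P.state 0 P.q₀) (P.state 0 P.q₁) X x = P.state 0 q := by
  have := P.q₁_lt_q₀.le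
  unfold normalShock
  split_ifs
  exacts [⟨_, ⟨this, le_rfl⟩, rfl⟩, ⟨_, ⟨le_rfl, this⟩, rfl⟩]

/-- Dominated convergence: the states are bounded uniformly for `s ≤ 1` and converge at every
interior point except possibly the front. -/
lemma tendsto_flow :
    TendstoL1 P.flow (normalShock (P.state 0 P.q₀) (P.state 0 P.q₁) P.front) (𝓝[>] 0) := by
  set N := normalShock (P.state 0 P.q₀) (P.state 0 P.q₁) P.front with hN
  have hq₁ := P.q₁_pos
  have hev : ∀ᶠ s in 𝓝[>] (0 : ℝ), s ∈ Ioc (0 : ℝ) 1 := Ioc_mem_nhdsGT zero_lt_one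
  have hae : ∀ᵐ x : ℝ, x ≠ P.front := by simp [ae_iff]
  have hmeas : ∀ f : GasState → ℝ, Measurable fun x => f (N x) := by
    intro f
    have : (fun x => f (N x)) = fun x =>
        if x < P.front then f (P.state 0 P.q₀) else f (P.state 0 P.q₁) := by
      funext x
      rw [hN, normalShock, apply_ite f]
    rw [this]
    exact Measurable.ite measurableSet_Iio measurable_const measurable_const
  have hlim : ∀ f : GasState → ℝ, (∀ q ∈ Icc P.q₁ P.q₀,
      ContinuousAt (fun y : ℝ × ℝ => f (P.state y.1 y.2)) (0, q)) →
      ∀ᵐ x, x ∈ Ioo (0 : ℝ) 1 → Tendsto (fun s => f (P.flow s x)) (𝓝[>] 0) (𝓝 (f (N x))) := by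
    intro f hf
    filter_upwards [hae] with x hx hx'
    have hid : Tendsto (fun s : ℝ => s) (𝓝[>] 0) (𝓝 0) := nhdsWithin_le_nhds
    rcases lt_or_gt_of_ne hx with h | h
    · have e : N x = P.state 0 P.q₀ := if_pos h
      rw [e]
      exact (hf P.q₀ ⟨P.q₁_lt_q₀.le, le_rfl⟩).tendsto.comp
        (hid.prodMk_nhds (tendsto_profile_q₀ hx' h))
    · have e : N x = P.state 0 P.q₁ := if_neg h.le.not_gt
      rw [e]
      exact (hf P.q₁ ⟨le_rfl, P.q₁_lt_q₀.le⟩).tendsto.comp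
        (hid.prodMk_nhds (tendsto_profile_q₁ hx' h))
  have hbound : ∀ (f : GasState → ℝ) (C : ℝ),
      (∀ s ∈ Icc (0 : ℝ) 1, ∀ u ∈ Icc P.q₁ P.q₀, f (P.state s u) ∈ Icc 0 C) →
      ∀ᶠ s in 𝓝[>] (0 : ℝ), ∀ x ∈ Ioo (0 : ℝ) 1, |f (P.flow s x) - f (N x)| ≤ C := by
    intro f C hf
    filter_upwards [hev] with s hs x hx
    obtain ⟨q, hq, e⟩ := P.normalShock_state P.front x
    have h1 := hf s (Ioc_subset_Icc_self hs) _ (profile_mem hs.1 (Ioo_subset_Icc_self hx))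
    have h2 := hf 0 (by simp) q hq
    rw [hN, e, flow]
    exact abs_sub_le_iff.2 ⟨by linarith [h1.2, h2.1], by linarith [h2.2, h1.1]⟩
  have hne : ∀ q ∈ Icc P.q₁ P.q₀, q ≠ 0 := fun q hq => (hq₁.trans_le hq.1).ne'
  have hg := P.continuous_g
  refine ⟨tendsto_eLpNorm_one_of_bounded (C := P.q₀) ?_ (hbound GasState.u _ ?_)
      (hlim GasState.u ?_),
    tendsto_eLpNorm_one_of_bounded ?_ (hbound GasState.ρ _ fun s _ u hu => state_ρ_mem hu)
      (hlim GasState.ρ ?_),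
    tendsto_eLpNorm_one_of_bounded ?_ (hbound GasState.p _ fun s hs u hu => state_p_mem hs hu)
      (hlim GasState.p ?_)⟩
  · filter_upwards [hev] with s hs
    exact (continuous_profile hs.1).measurable.sub (hmeas _)
  · exact fun s _ u hu => ⟨hq₁.le.trans hu.1, hu.2⟩
  · exact fun q _ => continuous_snd.continuousAt
  · filter_upwards [hev] with s hs
    exact (measurable_const.div (continuous_profile hs.1).measurable).sub (hmeas _)
  · exact fun q hq => continuousAt_const.div continuous_snd.continuousAt (hne q hq)
  · filter_upwards [hev] with s hs
    have hv := (continuous_profile (P := P) hs.1).measurable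
    have hgv := (hg.comp (continuous_profile (P := P) hs.1)).measurable
    exact ((measurable_const.mul (hgv.add (measurable_const.mul (measurable_const.sub hv)))).div
      hv).sub (hmeas _)
  · exact fun q hq => ContinuousAt.div (by fun_prop) continuous_snd.continuousAt (hne q hq)

/-- For large stress parameters the pressure is of the order of `s` on a fixed interval. -/
lemma exists_le_flow_p : ∃ c : ℝ, 0 < c ∧ ∃ x₀ ∈ Ico (0 : ℝ) 1, ∀ s, 1 ≤ s →
    ∀ x ∈ Ioo x₀ 1, c * s ≤ (P.flow s x).p := by
  have hlt := P.q₁_lt_q₀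
  have hq₁ := P.q₁_pos
  have hq₀ := P.q₀_pos
  have hm := P.m_pos
  have hγ : 0 < P.γ - 1 := by linarith [P.one_lt_γ]
  obtain ⟨u, h1, h2⟩ := exists_between hlt
  obtain ⟨c, hc, hle⟩ := exists_le_integral h1 h2
  obtain ⟨C, hC, hge⟩ := P.exists_travel_le
  -- The distance spent below `u` is at least `c * s^(δ-1)` and the whole at most `C * s^(δ-1)`. A
  -- share of at least `c / C` is therefore travelled below `u`, where the stress term in the
  -- pressure is at least `s * (q₀ - u)`.
  refine ⟨(P.γ - 1) * P.m * (P.q₀ - u) / P.q₀,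
    div_pos (mul_pos (mul_pos hγ hm) (by linarith)) hq₀, max 0 (1 - c / C),
    ⟨le_max_left _ _, max_lt zero_lt_one (by have := div_pos hc hC; linarith)⟩,
    fun s hs x hx => ?_⟩
  have hs0 : 0 < s := by linarith
  have hx0 : x ∈ Icc (0 : ℝ) 1 := ⟨(le_max_left _ _).trans hx.1.le, hx.2.le⟩
  have ht := travel_pos (P := P) hs0
  have hvu : P.profile s x < u := by
    rw [profile_lt_iff hs0 h1.le h2.le]
    refine lt_of_le_of_lt ?_ ((le_max_right _ _).trans_lt hx.1)
    have e := integral_add_integral (P := P) hs0 h1.le h2.le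
    have e2 : (∫ w in u..P.q₀, P.dist s w) = P.travel s - ∫ w in P.q₁..u, P.dist s w := by
      linarith
    rw [e2, sub_div, div_self ht.ne']
    have : c / C ≤ (∫ w in P.q₁..u, P.dist s w) / P.travel s := by
      rw [div_le_div_iff₀ hC ht]
      calc c * P.travel s ≤ c * (C * s ^ (P.δ - 1)) := by
            have := hge s hs
            gcongr
        _ = (c * s ^ (P.δ - 1)) * C := by ring
        _ ≤ _ := by
            have := hle s hs
            gcongr
    linarith
  have hv := profile_mem (P := P) hs0 hx0
  have hv0 : 0 < P.profile s x := hq₁.trans_le hv.1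
  have hg := P.g_pos hv.2
  have h3 : (P.q₀ - u) * s ≤ P.g (P.profile s x) + s * (P.q₀ - P.profile s x) := by nlinarith
  simp only [flow, state]
  calc _ = (P.γ - 1) * P.m * ((P.q₀ - u) * s) / P.q₀ := by ring
    _ ≤ _ := by
      have h4 : 0 ≤ (P.q₀ - u) * s := mul_nonneg (by linarith) hs0.le
      have := hv.2
      gcongr

/-- Convergence would eventually bound the `L¹` norm of the pressure by one plus that of the limit,
while `exists_le_flow_p` makes it at least `c * (1 - x₀) * σ n`. -/
lemma not_tendsto_flow {V : ℝ → GasState} (hV : IntegrableState V) {σ : ℕ → ℝ}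
    (hσ : Tendsto σ atTop atTop) : ¬ TendstoL1 (fun n => P.flow (σ n)) V atTop := by
  rintro ⟨-, -, hp⟩
  obtain ⟨c, hc, x₀, hx₀, hle⟩ := P.exists_le_flow_p
  set ν := volume.restrict (Ioo (0 : ℝ) 1) with hν
  have hVp : eLpNorm (fun x => (V x).p) 1 ν < ⊤ :=
    (memLp_one_iff_integrable.2 hV.2.2).eLpNorm_lt_top
  set B := 1 + eLpNorm (fun x => (V x).p) 1 ν with hB
  have hBt : B ≠ ⊤ := (ENNReal.add_lt_top.2 ⟨ENNReal.one_lt_top, hVp⟩).ne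
  have hx1 : 0 < 1 - x₀ := by linarith [hx₀.2]
  have hbig : ∀ᶠ n in atTop, B.toReal < c * (1 - x₀) * σ n :=
    (hσ.const_mul_atTop (mul_pos hc hx1)).eventually_gt_atTop _
  obtain ⟨n, h1, h2, h3⟩ := ((hσ.eventually_ge_atTop 1).and (hbig.and
    (hp.eventually_le_const zero_lt_one))).exists
  have hs0 : 0 < σ n := by linarith
  have hmeas : Measurable fun x => (P.flow (σ n) x).p := by
    have hv := (continuous_profile (P := P) hs0).measurable
    have hgv := (P.continuous_g.comp (continuous_profile (P := P) hs0)).measurable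
    exact (measurable_const.mul (hgv.add (measurable_const.mul (measurable_const.sub hv)))).div hv
  have hup : eLpNorm (fun x => (P.flow (σ n) x).p) 1 ν ≤ B := by
    have e : (fun x => (P.flow (σ n) x).p) =
        (fun x => (P.flow (σ n) x).p - (V x).p) + fun x => (V x).p := by
      funext x; simp
    rw [e]
    refine (eLpNorm_add_le (hmeas.aestronglyMeasurable.sub hV.2.2.aestronglyMeasurable)
      hV.2.2.aestronglyMeasurable le_rfl).trans ?_
    exact add_le_add h3 le_rfl
  have hlow : ENNReal.ofReal (c * σ n) * ENNReal.ofReal (1 - x₀) ≤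
      eLpNorm (fun x => (P.flow (σ n) x).p) 1 ν := by
    rw [eLpNorm_one_eq_lintegral_enorm, ← Real.volume_Ioo, ← setLIntegral_const]
    refine le_trans ?_ (lintegral_mono_set (Ioo_subset_Ioo_left hx₀.1))
    refine setLIntegral_mono' measurableSet_Ioo fun x hx => ?_
    rw [← ofReal_norm]
    exact ENNReal.ofReal_le_ofReal ((hle _ h1 x hx).trans (le_abs_self _))
  rw [← ENNReal.ofReal_mul (by positivity)] at hlow
  have := (ENNReal.ofReal_le_iff_le_toReal hBt).1 (hlow.trans hup)
  linarith

end Params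

/-! ### Inverse branches of a monotone function. -/

/-- Inverse branch of a function that decreases from `∞` near `0`. -/
lemma exists_branch_zero {f : ℝ → ℝ} (hc : ContinuousOn f (Ioi 0))
    (ht : Tendsto f (𝓝[>] 0) atTop) {s₀ : ℝ} (hs₀ : 0 < s₀) (ha : StrictAntiOn f (Ioc 0 s₀)) :
    ∃ σ : ℝ → ℝ, (∀ y, f s₀ < y → σ y ∈ Ioo 0 s₀ ∧ f (σ y) = y) ∧
      Tendsto σ atTop (𝓝[>] 0) := by
  have hex : ∀ y, ∃ s, f s₀ < y → s ∈ Ioo 0 s₀ ∧ f s = y := by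
    intro y
    by_cases hy : f s₀ < y
    · obtain ⟨a, ha1, ha2⟩ := ((ht.eventually_gt_atTop y).and (Ioo_mem_nhdsGT hs₀)).exists
      obtain ⟨s, hs, e⟩ := intermediate_value_Icc' ha2.2.le
        (hc.mono fun z hz => ha2.1.trans_le hz.1) ⟨hy.le, ha1.le⟩
      refine ⟨s, fun _ => ⟨⟨ha2.1.trans_le hs.1, hs.2.lt_of_ne ?_⟩, e⟩⟩
      rintro rfl
      exact hy.ne e
    -- Below the threshold nothing is claimed, and `0` is a dummy value.
    · exact ⟨0, fun h => absurd h hy⟩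
  choose σ hσ using hex
  refine ⟨σ, hσ, tendsto_nhdsWithin_iff.2 ⟨?_, ?_⟩⟩
  · refine tendsto_order.2 ⟨fun a ha0 => ?_, fun a ha0 => ?_⟩
    · filter_upwards [eventually_gt_atTop (f s₀)] with y hy using ha0.trans (hσ y hy).1.1
    · have he : 0 < min a s₀ := lt_min ha0 hs₀
      filter_upwards [eventually_gt_atTop (f s₀), eventually_gt_atTop (f (min a s₀))] with y hy hy'
      obtain ⟨h1, h2⟩ := hσ y hy
      by_contra! hlt
      have := ha.antitoneOn ⟨he, min_le_right _ _⟩ (Ioo_subset_Ioc_self h1)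
        ((min_le_left _ _).trans hlt)
      linarith
  · filter_upwards [eventually_gt_atTop (f s₀)] with y hy using (hσ y hy).1.1

/-- Inverse branch of a function that increases to `∞` at `∞`. -/
lemma exists_branch_atTop {f : ℝ → ℝ} {S : ℝ} (hc : ContinuousOn f (Ici S))
    (ht : Tendsto f atTop atTop) (hf : StrictMonoOn f (Ici S)) :
    ∃ σ : ℝ → ℝ, (∀ y, f S < y → S < σ y ∧ f (σ y) = y) ∧ Tendsto σ atTop atTop := by
  have hex : ∀ y, ∃ s, f S < y → S < s ∧ f s = y := by
    intro y
    by_cases hy : f S < y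
    · obtain ⟨b, hb1, hb2⟩ := ((ht.eventually_gt_atTop y).and (eventually_ge_atTop S)).exists
      obtain ⟨s, hs, e⟩ := intermediate_value_Icc hb2
        (hc.mono fun z hz => hz.1) ⟨hy.le, hb1.le⟩
      refine ⟨s, fun _ => ⟨hs.1.lt_of_ne ?_, e⟩⟩
      rintro rfl
      exact hy.ne e
    · exact ⟨0, fun h => absurd h hy⟩
  choose σ hσ using hex
  refine ⟨σ, hσ, tendsto_atTop.2 fun b => ?_⟩
  filter_upwards [eventually_gt_atTop (f S), eventually_gt_atTop (f (max b S))] with y hy hy'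
  obtain ⟨h1, h2⟩ := hσ y hy
  by_contra! hlt
  have := hf.monotoneOn h1.le (mem_Ici.2 (le_max_right b S)) (hlt.le.trans (le_max_left _ _))
  linarith

lemma TendstoL1.comp {ι κ : Type*} {U : ι → ℝ → GasState} {V : ℝ → GasState} {l : Filter ι}
    {k : Filter κ} (h : TendstoL1 U V l) {σ : κ → ι} (hσ : Tendsto σ k l) :
    TendstoL1 (fun i => U (σ i)) V k :=
  ⟨h.1.comp hσ, h.2.1.comp hσ, h.2.2.comp hσ⟩

/-! ### Shock relations and the Euler system. -/

/-- By Rankine–Hugoniot the fluxes of a normal shock are constant, so the weak form says only that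
the derivative of a test function has integral zero. -/
lemma weaklyConserved_const {F : ℝ → ℝ} {c : ℝ} (h : ∀ x, F x = c) : WeaklyConserved F := by
  obtain rfl : F = fun _ => c := funext h
  refine ⟨locallyIntegrableOn_const c, fun φ hφ hcs hsub => ?_⟩
  have hzero : ∀ x ∉ Ioo (0 : ℝ) 1, φ x = 0 := fun x hx =>
    image_eq_zero_of_notMem_tsupport fun hx' => hx (hsub hx')
  rw [integral_const_mul, ← integral_Ioc_eq_integral_Ioo,
    ← intervalIntegral.integral_of_le zero_le_one,
    intervalIntegral.integral_deriv_eq_sub (fun x _ => hφ.differentiable (by simp) x)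
      ((hφ.continuous_deriv (by simp)).intervalIntegrable _ _),
    hzero 0 (by simp), hzero 1 (by simp)]
  simp

lemma machNumber_sq {γ : ℝ} (hγ : 0 < γ) {U : GasState} (hU : U.IsPhysical) :
    machNumber γ U ^ 2 = U.u ^ 2 / (γ * U.p / U.ρ) := by
  have := hU.1
  have := hU.2
  rw [machNumber, soundSpeed, div_pow, sq_abs, Real.sq_sqrt (by positivity)]

namespace IsShockPair

variable {γ : ℝ} {U₀ U₁ : GasState}

lemma u_pos (hU : IsShockPair γ U₀ U₁) : 0 < U₁.u := by
  have h := hU.rankineHugoniot.mass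
  have h0 : 0 < massFlux U₀ := mul_pos hU.physical₀.1 hU.velocity_pos
  rw [h, massFlux] at h0
  exact (pos_iff_pos_of_mul_pos h0).1 hU.physical₁.1

lemma soundSpeed_lt (hγ : 1 < γ) (hU : IsShockPair γ U₀ U₁) : γ * U₀.p / U₀.ρ < U₀.u ^ 2 := by
  have h1 := hU.physical₀.1
  have h2 := hU.physical₀.2
  have h := one_lt_pow₀ hU.supersonic two_ne_zero
  rwa [machNumber_sq (by linarith) hU.physical₀, one_lt_div (by positivity)] at h

lemma lt_soundSpeed (hγ : 1 < γ) (hU : IsShockPair γ U₀ U₁) : U₁.u ^ 2 < γ * U₁.p / U₁.ρ := by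
  have h1 := hU.physical₁.1
  have h2 := hU.physical₁.2
  have h := pow_lt_one₀ (show 0 ≤ machNumber γ U₁ by unfold machNumber soundSpeed; positivity)
    hU.subsonic two_ne_zero
  rwa [machNumber_sq (by linarith) hU.physical₁, div_lt_one (by positivity)] at h

lemma bernoulli (hγ : 1 < γ) (hU : IsShockPair γ U₀ U₁) :
    (γ - 1) * U₀.u ^ 2 / 2 + γ * U₀.p / U₀.ρ = (γ - 1) * U₁.u ^ 2 / 2 + γ * U₁.p / U₁.ρ := by
  have h := hU.rankineHugoniot.energy
  have h3 : γ - 1 ≠ 0 := by linarith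
  have e : ∀ U : GasState,
      (γ - 1) * U.u ^ 2 / 2 + γ * U.p / U.ρ = (γ - 1) * bernoulliFunction γ U := by
    intro U
    simp only [bernoulliFunction, internalEnergy]
    field_simp
    ring
  rw [e, e, h]

/-- The Bernoulli sum is below `(γ + 1) / 2 * u²` at the supersonic state and above it at the
subsonic one. -/
lemma u_lt (hγ : 1 < γ) (hU : IsShockPair γ U₀ U₁) : U₁.u < U₀.u := by
  have h1 := hU.soundSpeed_lt hγ
  have h2 := hU.lt_soundSpeed hγ
  have h3 := hU.bernoulli hγ
  refine lt_of_pow_lt_pow_left₀ 2 hU.velocity_pos.le ?_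
  nlinarith

/-- The Prandtl relation. -/
lemma prandtl (hγ : 1 < γ) (hU : IsShockPair γ U₀ U₁) :
    (γ - 1) * U₀.u ^ 2 / 2 + γ * U₀.p / U₀.ρ = (γ + 1) / 2 * U₀.u * U₁.u := by
  have hmass := hU.rankineHugoniot.mass
  have hmom := hU.rankineHugoniot.momentum
  have hB := hU.bernoulli hγ
  have hlt := hU.u_lt hγ
  have hu0 := hU.velocity_pos
  have hu1 := hU.u_pos
  have hρ0 := hU.physical₀.1
  have hρ1 := hU.physical₁.1
  simp only [massFlux, momentumFlux] at hmass hmom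
  set c₀ := γ * U₀.p / U₀.ρ with hc₀
  set c₁ := γ * U₁.p / U₁.ρ with hc₁
  have e0 : γ * U₀.p = c₀ * U₀.ρ := by rw [hc₀]; field_simp
  have e1 : γ * U₁.p = c₁ * U₁.ρ := by rw [hc₁]; field_simp
  have e2 : γ * (U₀.ρ * U₀.u * U₀.u) + c₀ * U₀.ρ = γ * (U₀.ρ * U₀.u * U₁.u) + c₁ * U₁.ρ := by
    linear_combination γ * hmom - e0 + e1 - γ * U₁.u * hmass
  have e3 : γ * U₀.u * U₁.u * (U₀.u - U₁.u) + c₀ * U₁.u - c₁ * U₀.u = 0 := by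
    have : U₀.ρ * U₀.u ≠ 0 := by positivity
    apply mul_left_cancel₀ this
    linear_combination U₀.u * U₁.u * e2 + (-c₁ * U₀.u) * hmass
  have e4 : c₁ = (γ - 1) * U₀.u ^ 2 / 2 + c₀ - (γ - 1) * U₁.u ^ 2 / 2 := by linarith
  rw [e4] at e3
  -- Eliminating the densities and `c₁` leaves the factor `q₀ - q₁`, the trivial root of the jump
  -- conditions; dividing by it gives the relation.
  have e5 : U₀.u - U₁.u ≠ 0 := by linarith
  apply mul_left_cancel₀ e5
  linear_combination -e3

end IsShockPair

/-- The parameters of a shock pair. -/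
def IsShockPair.params {γ R δ : ℝ} (hγ : 1 < γ) (hR : 0 < R) (hδ : 0 < δ) {U₀ U₁ : GasState}
    (hU : IsShockPair γ U₀ U₁) (hM : machNumber γ U₀ ^ 2 < 2 * γ / (γ - 1)) : Params where
  γ := γ
  R := R
  δ := δ
  m := massFlux U₀
  q₀ := U₀.u
  q₁ := U₁.u
  one_lt_γ := hγ
  R_pos := hR
  δ_pos := hδ
  m_pos := mul_pos hU.physical₀.1 hU.velocity_pos
  q₁_pos := hU.u_pos
  q₁_lt_q₀ := hU.u_lt hγ
  -- The Prandtl relation expresses the squared sound speed through the velocities. The Mach number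
  -- bound then becomes this inequality times `(γ + 1) * q₀`.
  mul_q₀_lt := by
    have h1 := hU.physical₀.1
    have h2 := hU.physical₀.2
    have h3 := hU.prandtl hγ
    have h4 := hU.velocity_pos
    have hγ0 : 0 < γ := by linarith
    rw [machNumber_sq hγ0 hU.physical₀, div_lt_div_iff₀ (by positivity) (by linarith)] at hM
    refine lt_of_mul_lt_mul_left ?_ (show 0 ≤ (γ + 1) * U₀.u by positivity)
    nlinarith

lemma IsShockPair.sq_machNumber₀ {γ : ℝ} {U₀ U₁ : GasState} (hγ : 1 < γ)
    (hU : IsShockPair γ U₀ U₁) : machNumber γ U₀ ^ 2 =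
      U₀.u ^ 2 / ((γ + 1) / 2 * U₀.u * U₁.u - (γ - 1) * U₀.u ^ 2 / 2) := by
  rw [machNumber_sq (by linarith) hU.physical₀, ← hU.prandtl hγ, add_sub_cancel_left]

lemma IsShockPair.sq_machNumber₁ {γ : ℝ} {U₀ U₁ : GasState} (hγ : 1 < γ)
    (hU : IsShockPair γ U₀ U₁) : machNumber γ U₁ ^ 2 =
      U₁.u ^ 2 / ((γ + 1) / 2 * U₀.u * U₁.u - (γ - 1) * U₁.u ^ 2 / 2) := by
  rw [machNumber_sq (by linarith) hU.physical₁, ← hU.prandtl hγ, hU.bernoulli hγ,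
    add_sub_cancel_left]

lemma shockPosition_eq_machNumber {γ δ : ℝ} {U₀ U₁ : GasState} (hγ : 1 < γ)
    (hU : IsShockPair γ U₀ U₁) :
    shockPosition γ δ U₀.u U₁.u = (1 + (machNumber γ U₀ / machNumber γ U₁) ^ (2 * δ) *
      ((1 - (machNumber γ U₀ ^ 2)⁻¹) / ((machNumber γ U₁ ^ 2)⁻¹ - 1)) ^ (1 + 2 * δ))⁻¹ := by
  have hq₀ := hU.velocity_pos
  have hq₁ := hU.u_pos
  have hlt := hU.u_lt hγ
  have hp₀ := hU.physical₀
  have hp₁ := hU.physical₁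
  have h0 := hU.sq_machNumber₀ hγ
  have h1 := hU.sq_machNumber₁ hγ
  have hc0 : 0 < (γ + 1) / 2 * U₀.u * U₁.u - (γ - 1) * U₀.u ^ 2 / 2 := by
    rw [← hU.prandtl hγ, add_sub_cancel_left]
    exact div_pos (mul_pos (by linarith) hp₀.2) hp₀.1
  have hc1 : 0 < (γ + 1) / 2 * U₀.u * U₁.u - (γ - 1) * U₁.u ^ 2 / 2 := by
    rw [← hU.prandtl hγ, hU.bernoulli hγ, add_sub_cancel_left]
    exact div_pos (mul_pos (by linarith) hp₁.2) hp₁.1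
  have hγ1 : γ - 1 ≠ 0 := by linarith
  have hγ2 : γ + 1 ≠ 0 := by linarith
  have hd : U₀.u - U₁.u ≠ 0 := by linarith
  -- This quotient is just `q₁ / q₀`. Its first power is the last factor in `shockPosition`; the
  -- power `2 * δ` combines with the Mach numbers to the ratio of squared sound speeds `c₁ / c₀` to
  -- the power `δ`.
  have hr : (1 - (machNumber γ U₀ ^ 2)⁻¹) / ((machNumber γ U₁ ^ 2)⁻¹ - 1) = U₁.u / U₀.u := by
    rw [h0, h1]
    have e0 : 1 - (U₀.u ^ 2 / ((γ + 1) / 2 * U₀.u * U₁.u - (γ - 1) * U₀.u ^ 2 / 2))⁻¹ =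
        (γ + 1) / 2 * (U₀.u - U₁.u) / U₀.u := by
      rw [inv_div]; field_simp; ring
    have e1 : (U₁.u ^ 2 / ((γ + 1) / 2 * U₀.u * U₁.u - (γ - 1) * U₁.u ^ 2 / 2))⁻¹ - 1 =
        (γ + 1) / 2 * (U₀.u - U₁.u) / U₁.u := by
      rw [inv_div]; field_simp; ring
    rw [e0, e1]
    field_simp
  have hM0 : 0 ≤ machNumber γ U₀ / machNumber γ U₁ := by
    unfold machNumber soundSpeed; positivity
  have hr0 : 0 < U₁.u / U₀.u := by positivity
  rw [hr, Real.rpow_mul hM0, Real.rpow_two, Real.rpow_add hr0, Real.rpow_one, Real.rpow_mul hr0.le,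
    Real.rpow_two, div_pow, h0, h1, shockPosition, mul_comm (U₁.u / U₀.u), ← mul_assoc,
    ← Real.mul_rpow (by positivity) (by positivity)]
  congr 5
  have hc0' := hc0.ne'
  have hc1' := hc1.ne'
  have e0 : (γ + 1) / (γ - 1) - U₀.u / U₁.u =
      2 / ((γ - 1) * U₀.u * U₁.u) *
        ((γ + 1) / 2 * U₀.u * U₁.u - (γ - 1) * U₀.u ^ 2 / 2) := by
    field_simp
  have e1 : (γ + 1) / (γ - 1) - U₁.u / U₀.u =
      2 / ((γ - 1) * U₀.u * U₁.u) *
        ((γ + 1) / 2 * U₀.u * U₁.u - (γ - 1) * U₁.u ^ 2 / 2) := by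
    field_simp
  rw [e0, e1]
  generalize (γ + 1) / 2 * U₀.u * U₁.u - (γ - 1) * U₀.u ^ 2 / 2 = c₀ at *
  generalize (γ + 1) / 2 * U₀.u * U₁.u - (γ - 1) * U₁.u ^ 2 / 2 = c₁ at *
  field_simp

lemma isNormalShockSolution {γ X : ℝ} {U₀ U₁ : GasState} (hγ : 1 < γ)
    (hU : IsShockPair γ U₀ U₁) (hX : X ∈ Ioo (0 : ℝ) 1) :
    IsNormalShockSolution γ U₀ U₁ (normalShock U₀ U₁ X) := by
  obtain ⟨h1, h2, h3⟩ := hU.rankineHugoniot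
  have h4 : energyFlux γ U₀ = energyFlux γ U₁ := by
    simp only [massFlux] at h1
    simp only [energyFlux, h1, h3]
  refine ⟨⟨X, hX, rfl⟩, ⟨weaklyConserved_const (c := massFlux U₀) fun x => ?_,
    weaklyConserved_const (c := momentumFlux U₀) fun x => ?_,
    weaklyConserved_const (c := energyFlux γ U₀) fun x => ?_⟩, ?_⟩
  · unfold normalShock; split_ifs <;> simp [h1]
  · unfold normalShock; split_ifs <;> simp [h2]
  · unfold normalShock; split_ifs <;> simp [h4]
  · have hlt := hU.u_lt hγ
    have hm : 0 < U₀.ρ * U₀.u := mul_pos hU.physical₀.1 hU.velocity_pos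
    simp only [massFlux, momentumFlux] at h1 h2
    have : U₁.p - U₀.p = U₀.ρ * U₀.u * (U₀.u - U₁.u) := by
      linear_combination -h2 + U₁.u * h1
    have := mul_pos hm (sub_pos.2 hlt)
    linarith

/-! ### Counting solutions and assembling the theorem. -/

namespace Params

variable {P : Params}

/-- The inviscid temperatures at `q₀` and `q₁` share the factor `κ`, which cancels in the ratio of
the weights. -/
lemma front_eq : P.front = shockPosition P.γ P.δ P.q₀ P.q₁ := by
  have hγ := P.γ_pos
  have hq₀ := P.q₀_pos
  have hq₁ := P.q₁_pos
  have hlt := P.q₁_lt_q₀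
  have hk := P.factor_pos
  have hw0 := P.weight_pos hlt.le le_rfl
  have h0 := P.ratio_bound
  have h1 : P.q₁ / P.q₀ < (P.γ + 1) / (P.γ - 1) := by
    refine lt_trans ?_ h0
    exact ((div_lt_one hq₀).2 hlt).trans ((one_lt_div hq₁).2 hlt)
  have hL : P.q₀ - P.q₁ ≠ 0 := by linarith
  set A₀ := (P.γ + 1) / (P.γ - 1) - P.q₀ / P.q₁
  set A₁ := (P.γ + 1) / (P.γ - 1) - P.q₁ / P.q₀
  have hA₀ : 0 < A₀ := sub_pos.2 h0
  have hA₁ : 0 < A₁ := sub_pos.2 h1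
  set κ := (P.γ - 1) / P.R * (P.q₀ * P.q₁ / (2 * P.γ)) with hκ
  have hκ0 : 0 < κ := mul_pos hk (by positivity)
  have e0 : P.temp 0 P.q₀ = κ * A₀ := by simp only [temp, g_q₀, hκ, A₀]; ring
  have e1 : P.temp 0 P.q₁ = κ * A₁ := by simp only [temp, g_q₁, hκ, A₁]; ring
  have key : P.weight P.q₁ = P.weight P.q₀ * ((A₁ / A₀) ^ P.δ * (P.q₁ / P.q₀)) := by
    unfold weight
    rw [e0, e1, Real.div_rpow hA₁.le hA₀.le, Real.mul_rpow hκ0.le hA₀.le,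
      Real.mul_rpow hκ0.le hA₁.le]
    have := Real.rpow_pos_of_pos hA₀ P.δ
    field_simp
  rw [front, shockPosition, key, ← mul_add_one, div_mul_cancel_left₀ hw0.ne', add_comm]

lemma front_mem : P.front ∈ Ioo (0 : ℝ) 1 := by
  have hw0 := P.weight_pos P.q₁_lt_q₀.le le_rfl
  have hw1 := P.weight_pos le_rfl P.q₁_lt_q₀.le
  refine ⟨by unfold front; positivity, ?_⟩
  rw [front, div_lt_one (by positivity)]
  linarith

lemma tendsto_m_div : Tendsto (fun μ : ℝ => P.m / μ) (𝓝[>] 0) atTop := by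
  simpa [div_eq_mul_inv] using tendsto_inv_nhdsGT_zero.const_mul_atTop P.m_pos

lemma mul_travel_eq_iff {μ s : ℝ} (hμ : 0 < μ) : μ * P.travel s = P.m ↔ P.travel s = P.m / μ := by
  rw [eq_div_iff hμ.ne', mul_comm]

theorem exists_unique_solution (hδ : P.δ ≤ 1) {U₀ U₁ : GasState} (h0 : P.state 0 P.q₀ = U₀)
    (h1 : P.state 0 P.q₁ = U₁) :
    ∃ μ₁ : ℝ, 0 < μ₁ ∧ ∃ U : ℝ → ℝ → GasState,
      (∀ μ ∈ Ioo 0 μ₁, IsViscousShockSolution P.γ P.R P.δ μ U₀ U₁ (U μ) ∧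
        ∀ V : ℝ → GasState, IsViscousShockSolution P.γ P.R P.δ μ U₀ U₁ V →
          EqOn V (U μ) (Icc 0 1)) ∧
      TendstoL1 U (normalShock U₀ U₁ P.front) (𝓝[>] 0) := by
  have hU₁ : U₁.u = P.q₁ := by rw [← h1]; rfl
  obtain ⟨s₀, hs₀, hanti⟩ := P.exists_strictAntiOn_travel
  obtain ⟨σ, hσ, hσt⟩ := exists_branch_zero P.continuousOn_travel P.tendsto_travel_zero hs₀ hanti
  -- For `μ < m / C` the required value of `travel` exceeds `C`, so every root lies in `(0, s₀)`,
  -- where `travel` is injective.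
  obtain ⟨C, hC⟩ := P.exists_travel_le_on_Ici hδ hs₀
  have hC0 : 0 < C := (travel_pos hs₀).trans_le (hC s₀ le_rfl)
  refine ⟨P.m / C, div_pos P.m_pos hC0, fun μ => P.flow (σ (P.m / μ)), fun μ hμ => ?_, ?_⟩
  · have hy : C < P.m / μ := (lt_div_comm₀ hμ.1 hC0).1 hμ.2
    obtain ⟨ha, hb⟩ := hσ _ ((hC s₀ le_rfl).trans_lt hy)
    refine ⟨flow_isViscousShockSolution ha.1 ((mul_travel_eq_iff hμ.1).2 hb) h0 hU₁,
      fun V hV => ?_⟩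
    obtain ⟨s, hs, ht, he⟩ := exists_eqOn_flow hμ.1 h0 hU₁ hV
    rw [mul_travel_eq_iff hμ.1] at ht
    have hss : s < s₀ := by
      by_contra! h
      have := hC s h
      linarith
    have : s = σ (P.m / μ) :=
      hanti.injOn ⟨hs, hss.le⟩ (Ioo_subset_Ioc_self ha) (ht.trans hb.symm)
    rw [this] at he
    exact he
  · rw [← h0, ← h1]
    exact P.tendsto_flow.comp (hσt.comp P.tendsto_m_div)

theorem exists_two_solutions (hδ : 1 < P.δ) {U₀ U₁ : GasState} (h0 : P.state 0 P.q₀ = U₀)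
    (h1 : P.state 0 P.q₁ = U₁) :
    ∃ μ₂ : ℝ, 0 < μ₂ ∧ ∃ W₁ W₂ : ℝ → ℝ → GasState,
      (∀ μ ∈ Ioo 0 μ₂, IsViscousShockSolution P.γ P.R P.δ μ U₀ U₁ (W₁ μ) ∧
        IsViscousShockSolution P.γ P.R P.δ μ U₀ U₁ (W₂ μ) ∧
        ¬ EqOn (W₁ μ) (W₂ μ) (Icc 0 1) ∧
        ∀ V : ℝ → GasState, IsViscousShockSolution P.γ P.R P.δ μ U₀ U₁ V →
          EqOn V (W₁ μ) (Icc 0 1) ∨ EqOn V (W₂ μ) (Icc 0 1)) ∧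
      TendstoL1 W₁ (normalShock U₀ U₁ P.front) (𝓝[>] 0) ∧
      (∀ V : ℝ → GasState, IntegrableState V →
        ∀ m : ℕ → ℝ, (∀ n, m n ∈ Ioo 0 μ₂) → Tendsto m atTop (𝓝 0) →
          ¬ TendstoL1 (fun n => W₂ (m n)) V atTop) ∧
      Tendsto (fun μ => entranceStress P.R P.δ μ (W₂ μ)) (𝓝[>] 0) atBot := by
  have hU₁ : U₁.u = P.q₁ := by rw [← h1]; rfl
  obtain ⟨s₀, hs₀, hanti⟩ := P.exists_strictAntiOn_travel
  obtain ⟨σ, hσ, hσt⟩ := exists_branch_zero P.continuousOn_travel P.tendsto_travel_zero hs₀ hanti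
  obtain ⟨S', hS'1, hmono'⟩ := P.exists_strictMonoOn_travel hδ
  -- Taking `S ≥ s₀` makes the two branches disjoint. On the gap `[s₀, S]`, `travel` is bounded by
  -- some `C`, so for `μ < m / C` each root lies on one of the two branches.
  set S := max S' s₀ with hS
  have hS0 : 0 < S := hs₀.trans_le (le_max_right _ _)
  have hmono : StrictMonoOn P.travel (Ici S) := hmono'.mono (Ici_subset_Ici.2 (le_max_left _ _))
  obtain ⟨τ, hτ, hτt⟩ := exists_branch_atTop
    (P.continuousOn_travel.mono fun s hs => hS0.trans_le hs) (P.tendsto_travel_atTop hδ) hmono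
  obtain ⟨C, hC⟩ := P.exists_travel_le_on_Icc (b := S) hs₀
  have hCs := hC s₀ ⟨le_rfl, le_max_right _ _⟩
  have hCS := hC S ⟨le_max_right _ _, le_rfl⟩
  have hC0 : 0 < C := (travel_pos hs₀).trans_le hCs
  have hbr : ∀ μ ∈ Ioo 0 (P.m / C), (σ (P.m / μ) ∈ Ioo 0 s₀ ∧ P.travel (σ (P.m / μ)) = P.m / μ) ∧
      (S < τ (P.m / μ) ∧ P.travel (τ (P.m / μ)) = P.m / μ) := fun μ hμ => by
    have hy : C < P.m / μ := (lt_div_comm₀ hμ.1 hC0).1 hμ.2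
    exact ⟨hσ _ (hCs.trans_lt hy), hτ _ (hCS.trans_lt hy)⟩
  refine ⟨P.m / C, div_pos P.m_pos hC0, fun μ => P.flow (σ (P.m / μ)),
    fun μ => P.flow (τ (P.m / μ)), fun μ hμ => ?_, ?_, fun V hV m hm hmt => ?_, ?_⟩
  · have hy : C < P.m / μ := (lt_div_comm₀ hμ.1 hC0).1 hμ.2
    obtain ⟨⟨ha, hb⟩, hc, hd⟩ := hbr μ hμ
    have hτ0 := hS0.trans hc
    have hb' := (mul_travel_eq_iff hμ.1).2 hb
    have hd' := (mul_travel_eq_iff hμ.1).2 hd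
    refine ⟨flow_isViscousShockSolution ha.1 hb' h0 hU₁,
      flow_isViscousShockSolution hτ0 hd' h0 hU₁, fun h => ?_, fun V hV => ?_⟩
    · have e := eq_of_eqOn_flow ha.1 hτ0 hb' hd' h
      have : s₀ ≤ S := le_max_right _ _
      linarith [ha.2]
    · obtain ⟨s, hs, ht, he⟩ := exists_eqOn_flow hμ.1 h0 hU₁ hV
      rw [mul_travel_eq_iff hμ.1] at ht
      rcases lt_or_ge s s₀ with h | h
      · left
        have : s = σ (P.m / μ) :=
          hanti.injOn ⟨hs, h.le⟩ (Ioo_subset_Ioc_self ha) (ht.trans hb.symm)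
        rw [this] at he
        exact he
      · right
        have hSs : S < s := by
          by_contra! h'
          have := hC s ⟨h, h'⟩
          linarith
        have : s = τ (P.m / μ) := hmono.injOn hSs.le hc.le (ht.trans hd.symm)
        rw [this] at he
        exact he
  · rw [← h0, ← h1]
    exact P.tendsto_flow.comp (hσt.comp P.tendsto_m_div)
  · have hmt' : Tendsto m atTop (𝓝[>] 0) :=
      tendsto_nhdsWithin_iff.2 ⟨hmt, Eventually.of_forall fun n => (hm n).1⟩
    exact not_tendsto_flow hV (hτt.comp (P.tendsto_m_div.comp hmt'))
  · have hlim : Tendsto (fun μ => -(P.m * τ (P.m / μ))) (𝓝[>] 0) atBot :=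
      tendsto_neg_atTop_atBot.comp ((hτt.comp P.tendsto_m_div).const_mul_atTop P.m_pos)
    refine hlim.congr' ?_
    filter_upwards [Ioo_mem_nhdsGT (div_pos P.m_pos hC0)] with μ hμ
    obtain ⟨-, hc, hd⟩ := hbr μ hμ
    exact (entranceStress_flow (hS0.trans hc) ((mul_travel_eq_iff hμ.1).2 hd)).symm

end Params

namespace IsShockPair

variable {γ R δ : ℝ} {U₀ U₁ : GasState} (hγ : 1 < γ) (hR : 0 < R) (hδ : 0 < δ)
  (hU : IsShockPair γ U₀ U₁) (hM : machNumber γ U₀ ^ 2 < 2 * γ / (γ - 1))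

lemma state_q₀ : (hU.params hγ hR hδ hM).state 0 U₀.u = U₀ := by
  have hq₀ := hU.velocity_pos
  have hq₁ := hU.u_pos
  have hρ := hU.physical₀.1
  have hγ1 : γ - 1 ≠ 0 := by linarith
  have hP := hU.prandtl hγ
  ext
  · rfl
  · simp only [Params.state, params, massFlux]; field_simp
  · have e : (hU.params hγ hR hδ hM).g U₀.u =
        U₀.u * U₁.u / (2 * γ) * ((γ + 1) / (γ - 1) - U₀.u / U₁.u) :=
      (hU.params hγ hR hδ hM).g_q₀
    change (γ - 1) * (U₀.ρ * U₀.u) *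
      ((hU.params hγ hR hδ hM).g U₀.u + 0 * (U₀.u - U₀.u)) / U₀.u = U₀.p
    rw [e]
    field_simp at hP ⊢
    linarith

lemma state_q₁ : (hU.params hγ hR hδ hM).state 0 U₁.u = U₁ := by
  have hq₀ := hU.velocity_pos
  have hq₁ := hU.u_pos
  have hρ := hU.physical₁.1
  have hγ1 : γ - 1 ≠ 0 := by linarith
  have hP := (hU.bernoulli hγ).symm.trans (hU.prandtl hγ)
  have hm := hU.rankineHugoniot.mass
  ext
  · rfl
  · simp only [Params.state, params, hm]; simp only [massFlux]; field_simp
  · have e : (hU.params hγ hR hδ hM).g U₁.u =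
        U₀.u * U₁.u / (2 * γ) * ((γ + 1) / (γ - 1) - U₁.u / U₀.u) :=
      (hU.params hγ hR hδ hM).g_q₁
    change (γ - 1) * massFlux U₀ *
      ((hU.params hγ hR hδ hM).g U₁.u + 0 * (U₀.u - U₁.u)) / U₁.u = U₁.p
    rw [e, hm, massFlux]
    field_simp at hP ⊢
    linarith

end IsShockPair

end PolytropicFlow

theorem theorem2p4 (γ R δ : ℝ) (hγ : 1 < γ) (hR : 0 < R) (hδ : 0 < δ)
    (U₀ U₁ : PolytropicFlow.GasState) (hU : PolytropicFlow.IsShockPair γ U₀ U₁)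
    (hM : PolytropicFlow.machNumber γ U₀ ^ 2 < 2 * γ / (γ - 1))
    (M₀ M₁ X : ℝ) (hM₀ : M₀ = PolytropicFlow.machNumber γ U₀)
    (hM₁ : M₁ = PolytropicFlow.machNumber γ U₁)
    (hX : X = PolytropicFlow.shockPosition γ δ U₀.u U₁.u) :
    -- the two expressions for the position of the front agree
    X = (1 + (M₀ / M₁) ^ (2 * δ) *
        ((1 - (M₀ ^ 2)⁻¹) / ((M₁ ^ 2)⁻¹ - 1)) ^ (1 + 2 * δ))⁻¹ ∧
    X ∈ Ioo (0 : ℝ) 1 ∧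
    PolytropicFlow.IsNormalShockSolution γ U₀ U₁ (PolytropicFlow.normalShock U₀ U₁ X) ∧
    -- the case `δ ≤ 1`
    (δ ≤ 1 →
      ∃ μ₁ : ℝ, 0 < μ₁ ∧ ∃ U : ℝ → ℝ → PolytropicFlow.GasState,
        (∀ μ ∈ Ioo 0 μ₁, PolytropicFlow.IsViscousShockSolution γ R δ μ U₀ U₁ (U μ) ∧
          ∀ V : ℝ → PolytropicFlow.GasState,
            PolytropicFlow.IsViscousShockSolution γ R δ μ U₀ U₁ V → EqOn V (U μ) (Icc 0 1)) ∧
        PolytropicFlow.TendstoL1 U (PolytropicFlow.normalShock U₀ U₁ X) (𝓝[>] 0)) ∧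
    -- the case `δ > 1`
    (1 < δ →
      ∃ μ₂ : ℝ, 0 < μ₂ ∧ ∃ W₁ W₂ : ℝ → ℝ → PolytropicFlow.GasState,
        (∀ μ ∈ Ioo 0 μ₂, PolytropicFlow.IsViscousShockSolution γ R δ μ U₀ U₁ (W₁ μ) ∧
          PolytropicFlow.IsViscousShockSolution γ R δ μ U₀ U₁ (W₂ μ) ∧
          ¬ EqOn (W₁ μ) (W₂ μ) (Icc 0 1) ∧
          ∀ V : ℝ → PolytropicFlow.GasState,
            PolytropicFlow.IsViscousShockSolution γ R δ μ U₀ U₁ V →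
              EqOn V (W₁ μ) (Icc 0 1) ∨ EqOn V (W₂ μ) (Icc 0 1)) ∧
        PolytropicFlow.TendstoL1 W₁ (PolytropicFlow.normalShock U₀ U₁ X) (𝓝[>] 0) ∧
        -- `W₂` has no limit in `L¹(0, 1)`, even along a sequence of values of `μ`
        (∀ V : ℝ → PolytropicFlow.GasState, PolytropicFlow.IntegrableState V →
          ∀ m : ℕ → ℝ, (∀ n, m n ∈ Ioo 0 μ₂) → Tendsto m atTop (𝓝 0) →
            ¬ PolytropicFlow.TendstoL1 (fun n => W₂ (m n)) V atTop) ∧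
        Tendsto (fun μ => PolytropicFlow.entranceStress R δ μ (W₂ μ)) (𝓝[>] 0) atBot) := by
  set P := hU.params hγ hR hδ hM
  have hXf : X = P.front := hX.trans P.front_eq.symm
  have hXm : X ∈ Ioo (0 : ℝ) 1 := hXf ▸ P.front_mem
  have h0 : P.state 0 P.q₀ = U₀ := hU.state_q₀ hγ hR hδ hM
  have h1 : P.state 0 P.q₁ = U₁ := hU.state_q₁ hγ hR hδ hM
  refine ⟨?_, hXm, PolytropicFlow.isNormalShockSolution hγ hU hXm, fun h => ?_, fun h => ?_⟩
  · rw [hX, hM₀, hM₁]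
    exact PolytropicFlow.shockPosition_eq_machNumber hγ hU
  · rw [hXf]
    exact P.exists_unique_solution h h0 h1
  · rw [hXf]
    exact P.exists_two_solutions h h0 h1
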